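/- **Setting.** Let $(\mathbf x_i,y_i)_{i=1}^n\subseteq\mathbb R^d\times\{\pm1\}$ be a dataset and $f(\mathbf x;\theta)$ a model whose parameter $\theta=(W_1,\dots,W_K)\in\mathbb R^p$ is a collection of real matrices (of arbitrary shapes), with the Euclidean inner product. Let $\mathcal L(\theta)=\sum_i e^{-\varphi(y_if(\mathbf x_i;\theta))}$, where $\varphi\in C^2(\mathbb R)$, $0<\varphi'\le\Phi'$ and $0\le\varphi''\le\Phi''$ for some constants $\Phi',\Phi''$. Let $\partial$ denote the Clarke subdifferential (the convex hull of all limits of gradients at nearby points of differentiability), and let $\|\theta\|:=\|\theta\|_{\mathrm{msp}}:=\max_k\|W_k\|_{\mathrm{sp}}$, where $\|\cdot\|_{\mathrm{sp}}$ is the spectral norm. Let $c>0$ and $\eta(t)>0$ for $t\ge0$. A *momentum system* consists of a locally absolutely continuous curve $\theta:[0,\infty)\to\mathbb R^p$, a measurable choice $\mathbf g_t\in\partial\mathcal L(\theta_t)$, $t\ge0$, and $\mathbf m_t=\int_0^t c\,e^{-c(t-s)}\mathbf g_s\,ds=(M_1(t),\dots,M_K(t))$. It is a *Muon trajectory* (exact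 orthogonalization, shared schedule $\eta$) if for almost every $t\ge0$ and every $k$, $\frac{dW_k}{dt}=-\eta(t)\,U_k(t)V_k(t)^\top$ for some reduced singular value decomposition $M_k(t)=U_k(t)\Sigma_k(t)V_k(t)^\top$ (orthonormal columns, strictly positive singular values; in particular $U_kV_k^\top=0$ if $M_k(t)=0$). It is a trajectory of *normalized momentum steepest descent* for $\|\cdot\|$ if for almost every $t\ge0$ $$\frac{d\theta_t}{dt}\in\eta(t)\cdot\arg\min_{\|\mathbf u\|=1}\langle\mathbf u,\mathbf m_t\rangle .\tag{1}$$ **Statement.** Let $(\theta_t,\mathbf g_t,\mathbf m_t)$ be a Muon trajectory. 1. Inclusion (1), with $\|\cdot\|=\|\cdot\|_{\mathrm{msp}}$, holds for almost every $t\ge0$ with $\mathbf m_t\ne0$. In particular, if $\mathbf m_t\neq 0$ for almost every $t\ge 0$, then the trajectory is a trajectory of normalized momentum steepest descent for $\|\cdot\|_{\mathrm{msp}}$. 2. Assume moreover that for some $L\ge1$ and some $\bar\theta\in\mathbb R^p$: - $f(\mathbf x;\alpha\theta)=\alpha^Lf(\mathbf x;\theta)$ for all $\mathbf x$, $\theta$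 and $\alpha>0$; - $\eta$ is locally integrable on $[0,\infty)$, $\int_0^\infty\eta(t)\,dt=\infty$ and $\eta(t)=o(t^{1/L-1})$ as $t\to\infty$; - there are $N_{\min}>0$ and $t_0\ge0$ with $\|\theta_t\|\ge N_{\min}$ for all $t\ge t_0$; - $\theta_t/\|\theta_t\|\to\bar\theta$ as $t\to\infty$, with positive margin $\gamma(\bar\theta)=\min_iy_if(\mathbf x_i;\bar\theta/\|\bar\theta\|)>0$; - either (a) $f(\mathbf x;\cdot)\in C^1$ for every $\mathbf x$; or (b) $f(\mathbf x;\cdot)$ is locally Lipschitz and Whitney $C^1$-stratifiable (its graph admits a finite Whitney $C^1$ stratification satisfying the frontier condition and Whitney's condition (a)) for every $\mathbf x$, and there are $\mathbf h_i(t)\in\partial f(\mathbf x_i;\cdot)(\theta_t)$ with $\mathbf g_t=-\sum_i e^{-\varphi(z_i)}\varphi'(z_i)y_i\mathbf h_i(t)$, where $z_i=y_if(\mathbf x_i;\theta_t)$, for all $t\ge0$, such that $\mathbf h_i(t)/\|\theta_t\|^{L-1}$ converges as $t\to\infty$ for every $i$. Then $\mathbf m_t\neq0$ for all sufficiently large $t$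 (so (1) holds for almost every sufficiently large $t$), and $\bar\theta$ is the direction of a KKT point of $$\min_\theta\tfrac12\|\theta\|_{\mathrm{msp}}^2\quad\text{s.t.}\quad y_if(\mathbf x_i;\theta)\ge1\ \text{ for all } i;$$ that is, for some $\alpha>0$ the point $\hat\theta=\alpha\bar\theta$ is feasible and there are $\lambda_i\ge0$, $\mathbf h_i\in\partial f(\mathbf x_i;\cdot)(\hat\theta)$ and $\mathbf k\in\partial\big(\tfrac12\|\cdot\|_{\mathrm{msp}}^2\big)(\hat\theta)$ with $\sum_i\lambda_iy_i\mathbf h_i=\mathbf k$ and $\sum_i\lambda_i(y_if(\mathbf x_i;\hat\theta)-1)=0$. -/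

import Mathlib

open Filter Topology MeasureTheory

noncomputable section

/-! ### Clarke subdifferential, arcs and Whitney stratifications -/

section General

variable {E : Type*} [NormedAddCommGroup E] [InnerProductSpace ℝ E] [CompleteSpace E]

/-- The Clarke subdifferential: the convex hull of all limits of gradients of `F` taken along
sequences of differentiability points converging to `x`. -/
def clarkeSubdiff (F : E → ℝ) (x : E) : Set E :=
  convexHull ℝ {g : E | ∃ u : ℕ → E, (∀ k, DifferentiableAt ℝ F (u k)) ∧
    Tendsto u atTop (𝓝 x) ∧ Tendsto (fun k => gradient F (u k)) atTop (𝓝 g)}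

/-- An arc on `[0, ∞)`: a locally absolutely continuous curve, i.e. the integral of a locally
integrable velocity. (Values at negative times play no role.) -/
def IsArc (θ : ℝ → E) : Prop :=
  ∃ v : ℝ → E, (∀ T : ℝ, 0 ≤ T → IntervalIntegrable v volume 0 T) ∧
    ∀ t : ℝ, 0 ≤ t → θ t = θ 0 + ∫ s in (0 : ℝ)..t, v s

/-- An embedded `C¹` submanifold (of some constant codimension `r`): locally the zero set of a
`C¹` submersion to `ℝ^r`. -/
def IsC1Submanifold {V : Type*} [NormedAddCommGroup V] [NormedSpace ℝ V] (M : Set V) : Prop :=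
  ∃ r : ℕ, ∀ z ∈ M, ∃ (U : Set V) (F : V → EuclideanSpace ℝ (Fin r)),
    IsOpen U ∧ z ∈ U ∧ ContDiffOn ℝ 1 F U ∧
    (∀ w ∈ U, Function.Surjective (fderiv ℝ F w)) ∧ M ∩ U = {w ∈ U | F w = 0}

/-- The (co)normal space of `M` at `z`: the functionals vanishing on the tangent space at `z`.
For an embedded `C¹` submanifold the tangent cone is the tangent space. -/
def conormalSpace {V : Type*} [NormedAddCommGroup V] [NormedSpace ℝ V] (M : Set V) (z : V) :
    Set (V →L[ℝ] ℝ) :=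
  {ν | ∀ w ∈ tangentConeAt ℝ M z, ν w = 0}

/-- A Whitney `C¹` stratification of `Q`: a finite partition into nonempty `C¹` submanifolds
satisfying the frontier condition and Whitney's condition (a). -/
structure IsWhitneyC1Stratification {V : Type*} [NormedAddCommGroup V] [NormedSpace ℝ V]
    {n : ℕ} (S : Fin n → Set V) (Q : Set V) : Prop where
  nonempty : ∀ i, (S i).Nonempty
  disjoint : ∀ i j, i ≠ j → Disjoint (S i) (S j)
  cover : ⋃ i, S i = Q
  submanifold : ∀ i, IsC1Submanifold (S i)
  frontier : ∀ i j, (S i ∩ closure (S j)).Nonempty → S i ⊆ closure (S j)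
  whitney : ∀ (i j : Fin n) (z : ℕ → V) (z₀ : V) (ν : ℕ → V →L[ℝ] ℝ) (ν₀ : V →L[ℝ] ℝ),
    (∀ k, z k ∈ S j) → z₀ ∈ S i → Tendsto z atTop (𝓝 z₀) →
    (∀ k, ν k ∈ conormalSpace (S j) (z k)) → Tendsto ν atTop (𝓝 ν₀) →
    ν₀ ∈ conormalSpace (S i) z₀

/-- A function is Whitney `C¹`-stratifiable if its graph admits a Whitney `C¹` stratification. -/
def IsWhitneyC1Stratifiable (F : E → ℝ) : Prop :=
  ∃ (n : ℕ) (S : Fin n → Set (E × ℝ)),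
    IsWhitneyC1Stratification S {q : E × ℝ | q.2 = F q.1}

end General

/-! ### Loss, margin and the margin maximization problem -/

/-- The conditions on `φ` for a log-concave, exponentially tailed loss `ℓ(u) = exp (-φ u)`. -/
structure IsLogConcaveExpTailed (φ : ℝ → ℝ) : Prop where
  contDiff : ContDiff ℝ 2 φ
  deriv_pos : ∀ u, 0 < deriv φ u
  deriv_bdd : ∃ B : ℝ, ∀ u, deriv φ u ≤ B
  deriv2_nonneg : ∀ u, 0 ≤ deriv (deriv φ) u
  deriv2_bdd : ∃ B : ℝ, ∀ u, deriv (deriv φ) u ≤ B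

section Problem

variable {E : Type*} [NormedAddCommGroup E] [InnerProductSpace ℝ E] [CompleteSpace E]
variable {X : Type*} {n : ℕ}

/-- The training loss `∑ᵢ exp (-φ (yᵢ f(xᵢ; θ)))`. -/
def trainingLoss (φ : ℝ → ℝ) (x : Fin n → X) (y : Fin n → ℝ) (f : X → E → ℝ) (θ : E) : ℝ :=
  ∑ i, Real.exp (-φ (y i * f (x i) θ))

/-- The hard margin `min_i yᵢ f(xᵢ; θ / N θ)` with respect to the norm `N`. (For an empty dataset
the value is `0`.) -/
def hardMargin (N : E → ℝ) (x : Fin n → X) (y : Fin n → ℝ) (f : X → E → ℝ) (θ : E) : ℝ :=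
  ⨅ i, y i * f (x i) ((N θ)⁻¹ • θ)

/-- `θ` is a KKT point of `min ½ N(θ)²` subject to `yᵢ f(xᵢ; θ) ≥ 1` for all `i`. -/
def IsKKTPoint (N : E → ℝ) (x : Fin n → X) (y : Fin n → ℝ) (f : X → E → ℝ) (θ : E) : Prop :=
  (∀ i, 1 ≤ y i * f (x i) θ) ∧
  ∃ k ∈ clarkeSubdiff (fun ϑ => (1 / 2 : ℝ) * N ϑ ^ 2) θ,
  ∃ (lam : Fin n → ℝ) (h : Fin n → E),
    (∀ i, 0 ≤ lam i) ∧ (∀ i, h i ∈ clarkeSubdiff (f (x i)) θ) ∧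
    (∑ i, (lam i * y i) • h i) - k = 0 ∧
    ∑ i, lam i * (y i * f (x i) θ - 1) = 0

/-! ### Assumptions -/

/-- `f(x; ·)` is positively homogeneous of degree `L` for every input `x`. -/
def IsHomogeneousModel (f : X → E → ℝ) (L : ℝ) : Prop :=
  ∀ (a : X) (θ : E) (α : ℝ), 0 < α → f a (α • θ) = α ^ L * f a θ

/-- Learning rate assumption: `η` is locally integrable, `∫₀^∞ η = ∞` and
`η(t) = o(t^(1/L - 1))`. -/
structure IsMSDSchedule (η : ℝ → ℝ) (L : ℝ) : Prop where
  integrable : ∀ T : ℝ, 0 ≤ T → IntervalIntegrable η volume 0 T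
  integral_eq_top : Tendsto (fun T : ℝ => ∫ t in (0 : ℝ)..T, η t) atTop atTop
  isLittleO : η =o[atTop] fun t : ℝ => t ^ (1 / L - 1)

/-- The trajectory is eventually bounded away from the origin. -/
def IsNontrivialTrajectory (N : E → ℝ) (θ : ℝ → E) : Prop :=
  ∃ Nmin : ℝ, 0 < Nmin ∧ ∃ t₀ : ℝ, 0 ≤ t₀ ∧ ∀ t, t₀ ≤ t → Nmin ≤ N (θ t)

/-- The trajectory converges in direction to `θbar`, and `θbar` has positive margin. -/
def ConvergesInDirection (N : E → ℝ) (x : Fin n → X) (y : Fin n → ℝ) (f : X → E → ℝ)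
    (θ : ℝ → E) (θbar : E) : Prop :=
  Tendsto (fun t => (N (θ t))⁻¹ • θ t) atTop (𝓝 θbar) ∧ 0 < hardMargin N x y f θbar

/-- Convergence of the normalized model subgradients: the loss subgradients `g` decompose through
model subgradients `hᵢ(t) ∈ ∂f(xᵢ; θ_t)` such that each `hᵢ(t) / N(θ_t)^(L-1)` converges. -/
def NormalizedSubgradientsConverge (N : E → ℝ) (φ : ℝ → ℝ) (x : Fin n → X) (y : Fin n → ℝ)
    (f : X → E → ℝ) (L : ℝ) (θ g : ℝ → E) : Prop :=
  ∃ h : Fin n → ℝ → E,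
    (∀ i, ∀ t, 0 ≤ t → h i t ∈ clarkeSubdiff (f (x i)) (θ t)) ∧
    (∀ t, 0 ≤ t → g t = -∑ i,
      (Real.exp (-φ (y i * f (x i) (θ t))) * deriv φ (y i * f (x i) (θ t)) * y i) • h i t) ∧
    ∀ i, ∃ l : E, Tendsto (fun t => (N (θ t) ^ (L - 1))⁻¹ • h i t) atTop (𝓝 l)

/-! ### Momentum and normalized momentum steepest descent -/

/-- `θ` is an arc, `g` is a (measurable) choice of Clarke subgradients of `loss` along `θ`, and
`m` is the momentum estimate of `g` with smoothing parameter `c`, i.e. the solution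
`m_t = ∫₀ᵗ c e^{-c(t-s)} g_s ds` of `m' = c (g - m)`, `m_0 = 0`. -/
structure IsMomentumSystem (loss : E → ℝ) (c : ℝ) (θ g m : ℝ → E) : Prop where
  arc : IsArc θ
  subgrad : ∀ t, 0 ≤ t → g t ∈ clarkeSubdiff loss (θ t)
  measurable : AEStronglyMeasurable g (volume.restrict (Set.Ici 0))
  momentum : ∀ t, 0 ≤ t → m t = ∫ s in (0 : ℝ)..t, (c * Real.exp (-c * (t - s))) • g s

/-- The set `argmin_{N u = 1} ⟨u, a⟩`. -/
def steepestDirections (N : E → ℝ) (a : E) : Set E :=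
  {u | N u = 1 ∧ ∀ v, N v = 1 → inner ℝ u a ≤ inner ℝ v a}

/-- The normalized momentum steepest descent relation
`θ'(t) ∈ η(t) · argmin_{N u = 1} ⟨u, m_t⟩` at time `t`. -/
def NormalizedMSDStep (N : E → ℝ) (η : ℝ → ℝ) (θ m : ℝ → E) (t : ℝ) : Prop :=
  ∃ u ∈ steepestDirections N (m t), HasDerivAt θ (η t • u) t

/-- Trajectories of normalized momentum steepest descent with respect to the norm `N`. -/
structure IsNormalizedMSD (N : E → ℝ) (loss : E → ℝ) (c : ℝ) (η : ℝ → ℝ) (θ g m : ℝ → E) :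
    Prop extends IsMomentumSystem loss c θ g m where
  step : ∀ᵐ t ∂(volume.restrict (Set.Ici (0 : ℝ))), NormalizedMSDStep N η θ m t

end Problem

/-! ### Collections of matrices and Muon -/

/-- The space `ℝ^p` of parameters `(W_1, …, W_K)`, where `W_k` is an `a k × b k` matrix, with its
Euclidean structure. -/
abbrev MatrixParams {K : ℕ} (a b : Fin K → ℕ) : Type :=
  EuclideanSpace ℝ ((k : Fin K) × (Fin (a k) × Fin (b k)))

/-- The `k`-th weight matrix. -/
def weight {K : ℕ} {a b : Fin K → ℕ} (θ : MatrixParams a b) (k : Fin K) :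
    Matrix (Fin (a k)) (Fin (b k)) ℝ :=
  Matrix.of fun i j => θ ⟨k, (i, j)⟩

/-- The spectral norm of a matrix: its operator norm between Euclidean spaces. -/
def spectralNormOf {p q : ℕ} (W : Matrix (Fin p) (Fin q) ℝ) : ℝ :=
  ‖LinearMap.toContinuousLinearMap (Matrix.toEuclideanLin W)‖

/-- The max-spectral norm `max_k ‖W_k‖_sp`. -/
def maxSpectralNorm {K : ℕ} {a b : Fin K → ℕ} (θ : MatrixParams a b) : ℝ :=
  ⨆ k, spectralNormOf (weight θ k)

/-- `M = U diag(σ) Vᵀ` is a reduced singular value decomposition. -/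
structure IsReducedSVD {p q r : ℕ} (M : Matrix (Fin p) (Fin q) ℝ)
    (U : Matrix (Fin p) (Fin r) ℝ) (σ : Fin r → ℝ) (V : Matrix (Fin q) (Fin r) ℝ) : Prop where
  left_orthonormal : U.transpose * U = 1
  right_orthonormal : V.transpose * V = 1
  pos : ∀ i, 0 < σ i
  eq : M = U * Matrix.diagonal σ * V.transpose

/-- Trajectories of Muon with exact orthogonalization, run on every matrix with the shared
schedule `η`: for almost every `t` and every `k`, `W_k'(t) = -η(t) U Vᵀ`, where `U Σ Vᵀ` is a
reduced singular value decomposition of the `k`-th matrix of the momentum estimate. -/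
structure IsMuonTrajectory {K : ℕ} {a b : Fin K → ℕ} (loss : MatrixParams a b → ℝ) (c : ℝ)
    (η : ℝ → ℝ) (θ g m : ℝ → MatrixParams a b) : Prop
    extends IsMomentumSystem loss c θ g m where
  step : ∀ᵐ t ∂(volume.restrict (Set.Ici (0 : ℝ))), ∃ w, HasDerivAt θ w t ∧
    ∀ k, ∃ (r : ℕ) (U : Matrix (Fin (a k)) (Fin r) ℝ) (σ : Fin r → ℝ)
      (V : Matrix (Fin (b k)) (Fin r) ℝ),
      IsReducedSVD (weight (m t) k) U σ V ∧ weight w k = -(η t • (U * V.transpose))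

end

/-! Steepest descent. If `M = U Σ Vᵀ`, then `⟨W, M⟩ = ∑ σᵢ (Uᵀ W V)ᵢᵢ ≤ ∑ σᵢ` on the spectral unit
ball, with equality at the polar factor `U Vᵀ`, whose norm is 1 unless `M = 0`. The unit ball of the
max-spectral norm is a product of spectral balls, so blockwise maximizers form a global one
(`IsReducedSVD.trace_le`, `IsReducedSVD.norm_polar`).

KKT direction. Let `N` be the norm of `θ_t`, `zᵢ` the margins, `S` the loss, `B` the total weight of
the normalized subgradients in the gradient `g`, and `γᵢ` the margins of `θbar`. The schedule forces
`N^(L-1) η → 0`, so margins and logarithms of weights vary slowly and the moving average `m` equals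
`g` up to `o(B)` (`tendsto_momentum_sub_grad`). Muon is thus asymptotically steepest descent on `S`.

Two rates are then compared. If the dual norm of `g` were eventually at least `r B`, then `log S`
would fall at speed about `r p η N^(L-1)`, where `p = lim φ'`. But `N^L` grows at speed at most `L η
N^(L-1)`, while `-log S ≤ φ(z_j)`, which is about `p γ_j N^L`. Hence `r ≤ L γ_j` (`rate_le`).

So at arbitrarily late times the dual norm of `g / B` is at most `L γ_j + o(1)`. Take `j` of minimal
margin. A limit of `-g / B` is a convex combination of limiting subgradients of dual norm at most `L
γ_j`, in which only minimal margins carry weight (`exists_aligned`); by Euler's identity its pairing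
with `θbar` is exactly `L γ_j`. It is therefore a multiple of a subgradient of half the squared norm
at `θbar`, which after rescaling is the KKT condition (`exists_isKKTPoint_of_aligned`).

For nonsmooth models, the chain rule along the curve comes from Whitney's condition (a)
(`IsWhitneyC1Stratifiable.ae_inner_eq`), and the limits of normalized subgradients are subgradients
at `θbar` by outer semicontinuity. -/

/-! ### The Clarke subdifferential -/

section Clarke

/-- In finite dimension, the convex hull of a compact set is compact. -/
theorem isCompact_convexHull_of_finiteDimensional {V : Type*} [NormedAddCommGroup V]
    [NormedSpace ℝ V] [FiniteDimensional ℝ V] {s : Set V} (hs : IsCompact s) :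
    IsCompact (convexHull ℝ s) := by
  rcases s.eq_empty_or_nonempty with rfl | ⟨p, hp⟩
  · simp
  set n := Module.finrank ℝ V + 1
  let Φ : (Fin n → ℝ) × (Fin n → V) → V := fun q => ∑ i, q.1 i • q.2 i
  have hK : IsCompact (stdSimplex ℝ (Fin n) ×ˢ Set.pi Set.univ fun _ : Fin n => s) :=
    (isCompact_stdSimplex ℝ (Fin n)).prod (isCompact_univ_pi fun _ => hs)
  have hΦ : Continuous Φ := by fun_prop
  convert! hK.image hΦ
  apply Set.Subset.antisymm
  · intro x hx
    obtain ⟨ι, _, z, w, hz, hind, hw, hsum, rfl⟩ := eq_pos_convex_span_of_mem_convexHull hx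
    have hcard : Fintype.card ι ≤ Fintype.card (Fin n) := by
      rw [Fintype.card_fin]
      exact hind.card_le_finrank_succ.trans (Nat.succ_le_succ (Submodule.finrank_le _))
    obtain ⟨e⟩ := Function.Embedding.nonempty_of_card_le hcard
    have hw0 : ∀ j, j ∉ Set.range e → Function.extend e w 0 j = 0 := fun j hj => by
      rw [Function.extend_apply' _ _ _ (by simpa using hj)]; rfl
    -- Carathéodory may use fewer than `n` points; the spare slots get weight 0 and the filler point
    -- `p`.
    refine ⟨(Function.extend e w 0, Function.extend e z fun _ => p), ⟨⟨fun j => ?_, ?_⟩, ?_⟩, ?_⟩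
    · by_cases hj : j ∈ Set.range e
      · obtain ⟨i, rfl⟩ := hj
        simpa only [e.injective.extend_apply] using (hw i).le
      · exact (hw0 j hj).ge
    · rw [← hsum]
      exact (Fintype.sum_of_injective e e.injective _ _ hw0
        fun i => (e.injective.extend_apply _ _ _).symm).symm
    · intro j _
      by_cases hj : j ∈ Set.range e
      · obtain ⟨i, rfl⟩ := hj
        simpa only [e.injective.extend_apply] using hz ⟨i, rfl⟩
      · simpa only [Function.extend_apply' _ _ _ (show ¬ ∃ a, e a = j by simpa using hj)] using hp
    · refine (Fintype.sum_of_injective e e.injective _ _ (fun j hj => ?_) fun i => ?_).symm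
      · simp only [hw0 j hj, zero_smul]
      · simp only [e.injective.extend_apply]
  · rintro _ ⟨⟨w, z⟩, ⟨hw, hz⟩, rfl⟩
    exact (convex_convexHull ℝ s).sum_mem (fun i _ => hw.1 i) hw.2
      fun i _ => subset_convexHull ℝ s (hz i trivial)

variable {E : Type*} [NormedAddCommGroup E] [InnerProductSpace ℝ E] [CompleteSpace E]

/-- The limits of gradients of `F` along sequences of differentiability points converging
to `x`. -/
def gradientLimits (F : E → ℝ) (x : E) : Set E :=
  {g : E | ∃ u : ℕ → E, (∀ k, DifferentiableAt ℝ F (u k)) ∧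
    Tendsto u atTop (𝓝 x) ∧ Tendsto (fun k => gradient F (u k)) atTop (𝓝 g)}

/-- The ε-form spares a diagonal sequence in the proof of closedness. -/
theorem mem_gradientLimits_iff {F : E → ℝ} {x g : E} :
    g ∈ gradientLimits F x ↔ ∀ ε > 0, ∃ u, DifferentiableAt ℝ F u ∧ dist u x < ε ∧
      dist (gradient F u) g < ε := by
  constructor
  · rintro ⟨u, hd, hu, hg⟩ ε hε
    obtain ⟨k, h1, h2⟩ := ((Metric.tendsto_nhds.1 hu ε hε).and
      (Metric.tendsto_nhds.1 hg ε hε)).exists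
    exact ⟨u k, hd k, h1, h2⟩
  · intro h
    choose u hd hu hg using fun k : ℕ => h (1 / ((k : ℝ) + 1)) (by positivity)
    refine ⟨u, hd, ?_, ?_⟩ <;> rw [tendsto_iff_dist_tendsto_zero]
    · exact squeeze_zero (fun _ => dist_nonneg) (fun k => (hu k).le)
        tendsto_one_div_add_atTop_nhds_zero_nat
    · exact squeeze_zero (fun _ => dist_nonneg) (fun k => (hg k).le)
        tendsto_one_div_add_atTop_nhds_zero_nat

theorem isClosed_gradientLimits (F : E → ℝ) (x : E) : IsClosed (gradientLimits F x) := by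
  refine isClosed_of_closure_subset fun g hg => mem_gradientLimits_iff.2 fun ε hε => ?_
  obtain ⟨g', hg', hd⟩ := Metric.mem_closure_iff.1 hg (ε / 2) (by positivity)
  obtain ⟨u, h1, h2, h3⟩ := mem_gradientLimits_iff.1 hg' (ε / 2) (by positivity)
  refine ⟨u, h1, by linarith, ?_⟩
  have := dist_triangle (gradient F u) g' g
  rw [dist_comm] at hd
  linarith

theorem norm_gradient_le_of_lipschitzOnWith {F : E → ℝ} {s : Set E} {C : NNReal} {x : E}
    (hs : s ∈ 𝓝 x) (hF : LipschitzOnWith C F s) : ‖gradient F x‖ ≤ C := by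
  rw [← (InnerProductSpace.toDual ℝ E).norm_map, toDual_gradient]
  exact norm_fderiv_le_of_lipschitzOn ℝ hs hF

/-- The Clarke subdifferential of a locally Lipschitz function is locally bounded. -/
theorem LocallyLipschitz.eventually_norm_clarkeSubdiff_le {F : E → ℝ} (hF : LocallyLipschitz F)
    (x : E) : ∃ C : ℝ, ∀ᶠ y in 𝓝 x, ∀ h ∈ clarkeSubdiff F y, ‖h‖ ≤ C := by
  obtain ⟨C, s, hs, hC⟩ := hF x
  refine ⟨C, (eventually_mem_nhds_iff.2 hs).mono fun y hy h hh => ?_⟩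
  rw [← mem_closedBall_zero_iff]
  refine convexHull_min ?_ (convex_closedBall (0 : E) (C : ℝ)) hh
  rintro g ⟨u, -, hu, hg⟩
  rw [mem_closedBall_zero_iff]
  refine le_of_tendsto hg.norm ?_
  filter_upwards [hu.eventually (eventually_mem_nhds_iff.2 hy)] with k hk
  exact norm_gradient_le_of_lipschitzOnWith hk hC

theorem LocallyLipschitz.exists_norm_clarkeSubdiff_le {F : E → ℝ} (hF : LocallyLipschitz F)
    {s : Set E} (hs : IsCompact s) :
    ∃ C : ℝ, ∀ y ∈ s, ∀ h ∈ clarkeSubdiff F y, ‖h‖ ≤ C := by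
  refine hs.induction_on ⟨0, by simp⟩ (fun s t hst ⟨C, hC⟩ => ⟨C, fun y hy => hC y (hst hy)⟩)
    (fun s t ⟨C, hC⟩ ⟨D, hD⟩ => ⟨max C D, fun y hy h hh => ?_⟩) fun x _ => ?_
  · rcases hy with hy | hy
    · exact (hC y hy h hh).trans (le_max_left _ _)
    · exact (hD y hy h hh).trans (le_max_right _ _)
  · obtain ⟨C, hC⟩ := hF.eventually_norm_clarkeSubdiff_le x
    exact ⟨_, mem_nhdsWithin_of_mem_nhds hC, C, fun y hy => hy⟩

theorem gradient_mem_clarkeSubdiff {F : E → ℝ} {x : E} (hx : DifferentiableAt ℝ F x) :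
    gradient F x ∈ clarkeSubdiff F x :=
  subset_convexHull ℝ _ ⟨fun _ => x, fun _ => hx, tendsto_const_nhds, tendsto_const_nhds⟩

theorem exists_gradientLimits_inner_ge {F : E → ℝ} {x h : E} (hh : h ∈ clarkeSubdiff F x)
    (v : E) : ∃ g ∈ gradientLimits F x, inner ℝ v h ≤ inner ℝ v g :=
  ((innerₛₗ ℝ v).convexOn convex_univ).exists_ge_of_mem_convexHull (Set.subset_univ _) hh

/-- An affine identity satisfied by all limits of gradients holds on the Clarke
subdifferential. -/
theorem inner_eq_of_mem_clarkeSubdiff {F : E → ℝ} {x h v : E} {r : ℝ}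
    (hg : ∀ g ∈ gradientLimits F x, inner ℝ g v = r) (hh : h ∈ clarkeSubdiff F x) :
    inner ℝ h v = r := by
  have hconv : Convex ℝ {g : E | inner ℝ g v = r} := by
    intro a ha b hb s t _ _ hst
    simp only [Set.mem_ofPred_eq, inner_add_left, inner_smul_left] at *
    simp [ha, hb, ← add_mul, hst]
  exact convexHull_min hg hconv hh

theorem ConvexOn.add_inner_gradient_le {F : E → ℝ} (hF : ConvexOn ℝ Set.univ F) {u : E}
    (hu : DifferentiableAt ℝ F u) (x : E) : F u + inner ℝ (gradient F u) (x - u) ≤ F x := by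
  have hconv : ConvexOn ℝ Set.univ (F ∘ AffineMap.lineMap (k := ℝ) u x) :=
    hF.comp_affineMap (AffineMap.lineMap u x)
  have hd : HasDerivAt (F ∘ AffineMap.lineMap (k := ℝ) u x) (fderiv ℝ F u (x - u)) 0 := by
    refine HasFDerivAt.comp_hasDerivAt (0 : ℝ) ?_ AffineMap.hasDerivAt_lineMap
    rw [AffineMap.lineMap_apply_zero]
    exact hu.hasFDerivAt
  have := hconv.le_slope_of_hasDerivAt (Set.mem_univ 0) (Set.mem_univ 1) one_pos hd
  rw [slope_def_field] at this
  simp only [Function.comp_apply, AffineMap.lineMap_apply_zero, AffineMap.lineMap_apply_one,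
    sub_zero, div_one] at this
  rw [inner_gradient_left]
  linarith

/-! ### Membership criteria for the Clarke subdifferential in finite dimension -/

section FiniteDimensional

variable [FiniteDimensional ℝ E]

theorem LocallyLipschitz.isCompact_gradientLimits {F : E → ℝ} (hF : LocallyLipschitz F) (x : E) :
    IsCompact (gradientLimits F x) := by
  obtain ⟨C, hC⟩ := hF.eventually_norm_clarkeSubdiff_le x
  refine Metric.isCompact_of_isClosed_isBounded (isClosed_gradientLimits F x)
    (isBounded_iff_forall_norm_le.2 ⟨C, fun g hg => ?_⟩)
  exact hC.self_of_nhds g (subset_convexHull ℝ _ hg)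

/-- A vector belongs to the Clarke subdifferential as soon as it is dominated in every direction
by gradients at nearby points. -/
theorem LocallyLipschitz.mem_clarkeSubdiff_of_forall_inner {F : E → ℝ} (hF : LocallyLipschitz F)
    {x h : E} (H : ∀ v : E, ∀ ε > 0, ∃ u, DifferentiableAt ℝ F u ∧ dist u x < ε ∧
      inner ℝ v h - ε ≤ inner ℝ v (gradient F u)) : h ∈ clarkeSubdiff F x := by
  by_contra hh
  -- Separate `h` strictly from the compact hull by a vector `v`. A convergent subsequence of the
  -- nearby gradients dominating `h` along `v` gives a gradient limit on the wrong side.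
  obtain ⟨f, c, hc, hch⟩ := geometric_hahn_banach_closed_point (convex_convexHull ℝ _)
    (isCompact_convexHull_of_finiteDimensional (hF.isCompact_gradientLimits x)).isClosed hh
  obtain ⟨v, rfl⟩ := (InnerProductSpace.toDual ℝ E).surjective f
  simp only [InnerProductSpace.toDual_apply_apply] at hc hch
  choose u hd hu hg using fun k : ℕ => H v (1 / ((k : ℝ) + 1)) (by positivity)
  have hux : Tendsto u atTop (𝓝 x) := by
    rw [tendsto_iff_dist_tendsto_zero]
    exact squeeze_zero (fun _ => dist_nonneg) (fun k => (hu k).le)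
        tendsto_one_div_add_atTop_nhds_zero_nat
  obtain ⟨C, hC⟩ := hF.eventually_norm_clarkeSubdiff_le x
  have hb : ∃ᶠ k in atTop, gradient F (u k) ∈ Metric.closedBall (0 : E) C :=
    ((hux.eventually hC).mono fun k hk => by
      simpa using hk _ (gradient_mem_clarkeSubdiff (hd k))).frequently
  obtain ⟨g, -, ψ, hψ, hψg⟩ := tendsto_subseq_of_frequently_bounded Metric.isBounded_closedBall hb
  have hgm : g ∈ gradientLimits F x :=
    ⟨u ∘ ψ, fun k => hd _, hux.comp hψ.tendsto_atTop, hψg⟩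
  have h1 : inner ℝ v h - 0 ≤ inner ℝ v g :=
    le_of_tendsto_of_tendsto (tendsto_const_nhds.sub
      (tendsto_one_div_add_atTop_nhds_zero_nat.comp hψ.tendsto_atTop))
      (tendsto_const_nhds.inner hψg) (Eventually.of_forall fun k => hg (ψ k))
  have := hc g (subset_convexHull ℝ _ hgm)
  linarith

/-- The Clarke subdifferential of a locally Lipschitz function is outer semicontinuous. -/
theorem LocallyLipschitz.mem_clarkeSubdiff_of_tendsto {F : E → ℝ} (hF : LocallyLipschitz F)
    {ι : Type*} {l : Filter ι} [l.NeBot] {u h : ι → E} {x k : E} (hu : Tendsto u l (𝓝 x))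
    (hh : Tendsto h l (𝓝 k)) (hmem : ∀ᶠ i in l, h i ∈ clarkeSubdiff F (u i)) :
    k ∈ clarkeSubdiff F x := by
  refine hF.mem_clarkeSubdiff_of_forall_inner fun v ε hε => ?_
  obtain ⟨i, hi1, hi2, hi3⟩ := ((Metric.tendsto_nhds.1 hu (ε / 2) (by positivity)).and
    (((tendsto_const_nhds (x := v)).inner hh).eventually (lt_mem_nhds
      (show inner ℝ v k - ε / 2 < inner ℝ v k by linarith)) |>.and hmem)).exists
  -- In the direction `v`, `h i` is dominated by a gradient limit at `u i`, itself approximated by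
  -- gradients at points `w j` near `u i`.
  obtain ⟨g, ⟨w, hd, hw, hg⟩, hle⟩ := exists_gradientLimits_inner_ge hi3 v
  obtain ⟨j, hj1, hj2⟩ := ((Metric.tendsto_nhds.1 hw (ε / 2) (by positivity)).and
    (((tendsto_const_nhds (x := v)).inner hg).eventually (lt_mem_nhds
      (show inner ℝ v g - ε / 2 < inner ℝ v g by linarith)))).exists
  refine ⟨w j, hd j, ?_, by linarith⟩
  have := dist_triangle (w j) (u i) x
  linarith

/-- For a locally Lipschitz function, subgradients in the sense of convex analysis belong to the
Clarke subdifferential. -/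
theorem LocallyLipschitz.mem_clarkeSubdiff_of_convexOn {F : E → ℝ} (hF : LocallyLipschitz F)
    (hdiff : Dense {u | DifferentiableAt ℝ F u}) (hconv : ConvexOn ℝ Set.univ F) {x k : E}
    (hk : ∀ v, F x + inner ℝ k (v - x) ≤ F v) : k ∈ clarkeSubdiff F x := by
  refine hF.mem_clarkeSubdiff_of_forall_inner fun v ε hε => ?_
  obtain ⟨C, hC⟩ := hF.eventually_norm_clarkeSubdiff_le x
  obtain ⟨δ, hδ, hCδ⟩ := Metric.eventually_nhds_iff.1 hC
  -- `D` bounds `‖∇F u - k‖` near `x`. The point `x + t • v` need not be one of differentiability,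
  -- so it is moved by less than `t * τ`; this costs at most `D * t * τ ≤ t * ε` below, and `t`
  -- keeps `u` within `min δ ε` of `x`.
  set D := |C| + ‖k‖ + 1 with hD
  have hDpos : 0 < D := by positivity
  set τ := min 1 (ε / D)
  have hτ : 0 < τ := lt_min one_pos (by positivity)
  set t := min δ ε / (‖v‖ + 1)
  have ht : 0 < t := by positivity
  obtain ⟨u, hu, hud⟩ := Metric.dense_iff.1 hdiff (x + t • v) (t * τ) (by positivity)
  have hud : DifferentiableAt ℝ F u := hud
  rw [Metric.mem_ball, dist_eq_norm] at hu
  have hτ1 : τ ≤ 1 := min_le_left _ _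
  have hux : dist u x < min δ ε := by
    have h1 : u - x = (u - (x + t • v)) + t • v := by abel
    have h2 : ‖t • v‖ = t * ‖v‖ := by rw [norm_smul, Real.norm_of_nonneg ht.le]
    have h3 : t * (‖v‖ + 1) = min δ ε := div_mul_cancel₀ _ (by positivity)
    have h4 : t * τ ≤ t * 1 := by gcongr
    rw [dist_eq_norm, h1]
    linarith [norm_add_le (u - (x + t • v)) (t • v)]
  refine ⟨u, hud, hux.trans_le (min_le_right _ _), ?_⟩
  have hgC := hCδ (hux.trans_le (min_le_left _ _)) _ (gradient_mem_clarkeSubdiff hud)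
  -- Monotonicity of convex subgradients: add the two subgradient inequalities.
  have hmono : 0 ≤ inner ℝ (gradient F u - k) (u - x) := by
    have h1 := hconv.add_inner_gradient_le hud x
    have h2 := hk u
    rw [← neg_sub u x, inner_neg_right] at h1
    rw [inner_sub_left]
    linarith
  have h1 : u - x = (u - (x + t • v)) + t • v := by abel
  rw [h1, inner_add_right, inner_smul_right] at hmono
  have h2 : inner ℝ (gradient F u - k) (u - (x + t • v)) ≤ D * (t * τ) := by
    refine (real_inner_le_norm _ _).trans (mul_le_mul ?_ hu.le (norm_nonneg _) hDpos.le)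
    linarith [norm_sub_le (gradient F u) k, le_abs_self C]
  have h3 : D * τ ≤ ε := by
    have : D * τ ≤ D * (ε / D) := by gcongr; exact min_le_right _ _
    rwa [mul_div_cancel₀ _ hDpos.ne'] at this
  have h4 : 0 ≤ t * (ε + inner ℝ (gradient F u - k) v) := by nlinarith
  have h5 := nonneg_of_mul_nonneg_right h4 ht
  rw [inner_sub_left] at h5
  rw [real_inner_comm k v, real_inner_comm (gradient F u) v]
  linarith

end FiniteDimensional

/-! ### Homogeneous functions -/

/-- Differentiating `F = α ^ L * F (α⁻¹ • ·)` shows that gradients are homogeneous of degree `L -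
1`. -/
theorem hasGradientAt_smul_of_homogeneous {F : E → ℝ} {L : ℝ}
    (hF : ∀ (x : E) (α : ℝ), 0 < α → F (α • x) = α ^ L * F x) {x g : E} {α : ℝ} (hα : 0 < α)
    (hg : HasGradientAt F g x) : HasGradientAt F (α ^ (L - 1) • g) (α • x) := by
  rw [hasGradientAt_iff_hasFDerivAt] at hg ⊢
  have h1 : HasFDerivAt (fun z : E => α⁻¹ • z) (α⁻¹ • ContinuousLinearMap.id ℝ E) (α • x) :=
    (hasFDerivAt_id _).const_smul _
  have h2 : HasFDerivAt (fun z => α ^ L * F (α⁻¹ • z))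
      (α ^ L • (InnerProductSpace.toDual ℝ E g).comp (α⁻¹ • ContinuousLinearMap.id ℝ E))
      (α • x) := by
    refine HasFDerivAt.const_mul (HasFDerivAt.comp (α • x) ?_ h1) _
    rwa [inv_smul_smul₀ hα.ne']
  have h3 : (fun z => α ^ L * F (α⁻¹ • z)) = F := by
    funext z
    rw [← hF _ α hα, smul_inv_smul₀ hα.ne']
  rw [h3] at h2
  refine h2.congr_fderiv ?_
  ext z
  simp [Real.rpow_sub_one hα.ne']
  ring

theorem smul_mem_clarkeSubdiff_of_homogeneous {F : E → ℝ} {L : ℝ}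
    (hF : ∀ (x : E) (α : ℝ), 0 < α → F (α • x) = α ^ L * F x) {x h : E} {α : ℝ} (hα : 0 < α)
    (hh : h ∈ clarkeSubdiff F x) : α ^ (L - 1) • h ∈ clarkeSubdiff F (α • x) := by
  have h1 : α ^ (L - 1) • h ∈
      LinearMap.lsmul ℝ E (α ^ (L - 1)) '' convexHull ℝ (gradientLimits F x) := ⟨h, hh, rfl⟩
  rw [LinearMap.image_convexHull] at h1
  refine convexHull_mono ?_ h1
  rintro _ ⟨g, ⟨u, hd, hu, hg⟩, rfl⟩
  have hgrad := fun k => hasGradientAt_smul_of_homogeneous hF hα (hd k).hasGradientAt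
  refine ⟨fun k => α • u k, fun k => (hgrad k).differentiableAt, hu.const_smul α, ?_⟩
  simp only [fun k => (hgrad k).gradient]
  exact hg.const_smul _

/-- **Euler's identity** for the Clarke subdifferential of a homogeneous function. -/
theorem inner_clarkeSubdiff_of_homogeneous {F : E → ℝ} {L : ℝ}
    (hF : ∀ (x : E) (α : ℝ), 0 < α → F (α • x) = α ^ L * F x) (hcont : Continuous F) {x h : E}
    (hh : h ∈ clarkeSubdiff F x) : inner ℝ h x = L * F x := by
  refine inner_eq_of_mem_clarkeSubdiff ?_ hh
  rintro g ⟨u, hd, hu, hg⟩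
  refine tendsto_nhds_unique (hg.inner hu) ?_
  have hE : ∀ k, inner ℝ (gradient F (u k)) (u k) = L * F (u k) := by
    intro k
    have h1 : HasDerivAt (fun α : ℝ => F (α • u k)) (fderiv ℝ F (u k) (u k)) 1 := by
      have h0 : HasDerivAt (fun α : ℝ => α • u k) (u k) 1 := by
        simpa using (hasDerivAt_id (1 : ℝ)).smul_const (u k)
      refine HasFDerivAt.comp_hasDerivAt (1 : ℝ) ?_ h0
      rw [one_smul]
      exact (hd k).hasFDerivAt
    have h2 : HasDerivAt (fun α : ℝ => α ^ L * F (u k)) (L * F (u k)) 1 := by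
      simpa using (Real.hasDerivAt_rpow_const (p := L) (Or.inl one_ne_zero)).mul_const (F (u k))
    rw [inner_gradient_left]
    refine h1.unique (h2.congr_of_eventuallyEq ?_)
    filter_upwards [lt_mem_nhds (show (0 : ℝ) < 1 from one_pos)] with α hα using hF _ α hα
  simp only [hE]
  exact ((hcont.tendsto x).comp hu).const_mul L

/-! ### Continuously differentiable functions -/

theorem ContDiff.continuous_gradient {F : E → ℝ} (hF : ContDiff ℝ 1 F) :
    Continuous (gradient F) :=
  (InnerProductSpace.toDual ℝ E).symm.continuous.comp (hF.continuous_fderiv one_ne_zero)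

theorem ContDiff.clarkeSubdiff_eq {F : E → ℝ} (hF : ContDiff ℝ 1 F) (x : E) :
    clarkeSubdiff F x = {gradient F x} := by
  refine Set.Subset.antisymm ?_ ?_
  · refine convexHull_min ?_ (convex_singleton _)
    rintro g ⟨u, -, hu, hg⟩
    exact tendsto_nhds_unique hg ((hF.continuous_gradient.tendsto x).comp hu)
  · rintro _ rfl
    exact gradient_mem_clarkeSubdiff (hF.differentiable one_ne_zero x)

/-! ### The chain rule along curves for stratifiable functions -/

/-- For almost every time at which it lies in a set `s`, a differentiable curve is tangent
to `s`. -/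
theorem ae_hasDerivAt_mem_tangentConeAt {V : Type*} [NormedAddCommGroup V] [NormedSpace ℝ V]
    (γ : ℝ → V) (s : Set V) :
    ∀ᵐ t : ℝ, γ t ∈ s → ∀ w, HasDerivAt γ w t → w ∈ tangentConeAt ℝ s (γ t) := by
  -- Only countably many times in `γ ⁻¹' s` are isolated from the right. At any other, difference
  -- quotients along later times of return to `s` converge to the velocity.
  have hc := (countable_setOfPred_isolated_right_within (s := γ ⁻¹' s)).ae_notMem volume
  filter_upwards [hc] with t ht hts w hw
  have hne : (𝓝[γ ⁻¹' s ∩ Set.Ioi t] t).NeBot := ⟨fun h => ht ⟨hts, h⟩⟩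
  have hle : 𝓝[γ ⁻¹' s ∩ Set.Ioi t] t ≤ 𝓝[≠] t :=
    nhdsWithin_mono _ fun y hy => (ne_of_gt hy.2 : y ≠ t)
  refine mem_tangentConeAt_of_seq (𝓝[γ ⁻¹' s ∩ Set.Ioi t] t) (fun y => (y - t)⁻¹)
    (fun y => γ y - γ t) ?_ ?_ ((hasDerivAt_iff_tendsto_slope.1 hw).mono_left hle)
  · have := (hw.continuousAt.tendsto.mono_left (nhdsWithin_le_nhds (s := γ ⁻¹' s ∩ Set.Ioi t)))
    simpa using this.sub_const (γ t)
  · filter_upwards [self_mem_nhdsWithin] with y hy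
    simpa using hy.1

/-- The function `F q.1 - q.2` vanishes on `S`, so its derivative kills every tangent vector. -/
theorem gradient_mem_conormalSpace {F : E → ℝ} {S : Set (E × ℝ)}
    (hS : S ⊆ {q : E × ℝ | q.2 = F q.1}) {q : E × ℝ} (hq : q ∈ S)
    (hd : DifferentiableAt ℝ F q.1) :
    (InnerProductSpace.toDual ℝ E (gradient F q.1)).comp (ContinuousLinearMap.fst ℝ E ℝ) -
      ContinuousLinearMap.snd ℝ E ℝ ∈ conormalSpace S q := by
  intro w hw
  rw [toDual_gradient]
  have h1 : HasFDerivWithinAt (fun q : E × ℝ => F q.1 - q.2)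
      ((fderiv ℝ F q.1).comp (ContinuousLinearMap.fst ℝ E ℝ) - ContinuousLinearMap.snd ℝ E ℝ)
      S q :=
    ((hd.hasFDerivAt.comp q hasFDerivAt_fst).sub hasFDerivAt_snd).hasFDerivWithinAt
  have h2 : HasFDerivWithinAt (fun q : E × ℝ => F q.1 - q.2) (0 : E × ℝ →L[ℝ] ℝ) S q :=
    (hasFDerivWithinAt_const (0 : ℝ) q S).congr (fun z hz => by simp [show z.2 = _ from hS hz])
      (by simp [show q.2 = _ from hS hq])
  exact h1.unique_on h2 hw

/-- **Chain rule**: along a curve `θ`, all Clarke subgradients of a continuous function whose graph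
admits a Whitney stratification compute the derivative of the function at almost every time. -/
theorem IsWhitneyC1Stratifiable.ae_inner_eq {F : E → ℝ} (hF : IsWhitneyC1Stratifiable F)
    (hcont : Continuous F) (θ : ℝ → E) :
    ∀ᵐ t : ℝ, ∀ w r, HasDerivAt θ w t → HasDerivAt (fun s => F (θ s)) r t →
      ∀ h ∈ clarkeSubdiff F (θ t), inner ℝ h w = r := by
  obtain ⟨n, S, hS⟩ := hF
  have hae : ∀ᵐ t : ℝ, ∀ i, (θ t, F (θ t)) ∈ S i → ∀ w,
      HasDerivAt (fun s => (θ s, F (θ s))) w t → w ∈ tangentConeAt ℝ (S i) (θ t, F (θ t)) :=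
    ae_all_iff.2 fun i => ae_hasDerivAt_mem_tangentConeAt (fun s => (θ s, F (θ s))) (S i)
  filter_upwards [hae] with t ht w r hw hr h hh
  have hmem : ∀ x, ∃ i, (x, F x) ∈ S i := fun x => by
    have : (x, F x) ∈ ⋃ i, S i := by rw [hS.cover]; rfl
    exact Set.mem_iUnion.1 this
  obtain ⟨i, hi⟩ := hmem (θ t)
  have htan := ht i hi (w, r) (hw.prodMk hr)
  refine inner_eq_of_mem_clarkeSubdiff ?_ hh
  rintro g ⟨u, hd, hu, hg⟩
  choose j hj using fun k => hmem (u k)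
  -- With finitely many strata, some `j₀`, possibly different from `i`, recurs. Along it the
  -- conormals `(∇F, -1)` converge, and Whitney's condition (a) makes their limit annihilate the
  -- velocity `(w, r)`, tangent to stratum `i`.
  obtain ⟨j₀, hj₀⟩ : ∃ j₀, ∃ᶠ k in atTop, j k = j₀ := by
    by_contra! hcon
    obtain ⟨k, hk⟩ := (eventually_all.2 hcon).exists
    exact hk (j k) rfl
  obtain ⟨ψ, hψ, hψj⟩ := extraction_of_frequently_atTop hj₀
  let ν : E → (E × ℝ →L[ℝ] ℝ) := fun g =>
    (InnerProductSpace.toDual ℝ E g).comp (ContinuousLinearMap.fst ℝ E ℝ) -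
      ContinuousLinearMap.snd ℝ E ℝ
  have hν : Continuous ν := by
    refine Continuous.sub ?_ continuous_const
    exact ((ContinuousLinearMap.compL ℝ (E × ℝ) E ℝ).flip
      (ContinuousLinearMap.fst ℝ E ℝ)).continuous.comp
        (InnerProductSpace.toDual ℝ E).continuous
  have huψ := hu.comp hψ.tendsto_atTop
  have hsub : S j₀ ⊆ {q : E × ℝ | q.2 = F q.1} := hS.cover ▸ Set.subset_iUnion S j₀
  have hmemψ : ∀ k, (u (ψ k), F (u (ψ k))) ∈ S j₀ := fun k => hψj k ▸ hj (ψ k)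
  have hcon := hS.whitney i j₀ (fun k => (u (ψ k), F (u (ψ k)))) (θ t, F (θ t))
    (fun k => ν (gradient F (u (ψ k)))) (ν g) hmemψ hi
    (huψ.prodMk_nhds ((hcont.tendsto _).comp huψ))
    (fun k => gradient_mem_conormalSpace hsub (hmemψ k) (hd _))
    ((hν.tendsto g).comp (hg.comp hψ.tendsto_atTop)) (w, r) htan
  simpa [ν, sub_eq_zero] using hcon

end Clarke

/-! ### Absolutely continuous curves -/

namespace AbsolutelyContinuousOnInterval

variable {X Y : Type*} [PseudoMetricSpace X] [PseudoMetricSpace Y] {a b : ℝ}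

theorem of_dist_le {f : ℝ → X} {V : ℝ → Y} (hV : AbsolutelyContinuousOnInterval V a b) {C : ℝ}
    (h : ∀ s ∈ Set.uIcc a b, ∀ t ∈ Set.uIcc a b, dist (f s) (f t) ≤ C * dist (V s) (V t)) :
    AbsolutelyContinuousOnInterval f a b := by
  unfold AbsolutelyContinuousOnInterval at hV ⊢
  refine squeeze_zero' (Eventually.of_forall fun E => Finset.sum_nonneg fun _ _ => dist_nonneg) ?_
    (by simpa using hV.const_mul C)
  filter_upwards [mem_inf_of_right (mem_principal_self _)] with E hE
  rw [Finset.mul_sum]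
  exact Finset.sum_le_sum fun i hi => h _ (hE.1 i hi).1 _ (hE.1 i hi).2

theorem comp_lipschitzOnWith {f : ℝ → X} (hf : AbsolutelyContinuousOnInterval f a b)
    {G : X → Y} {C : NNReal} {s : Set X} (hG : LipschitzOnWith C G s)
    (hs : ∀ t ∈ Set.uIcc a b, f t ∈ s) : AbsolutelyContinuousOnInterval (G ∘ f) a b :=
  hf.of_dist_le fun u hu v hv => hG.dist_le_mul _ (hs u hu) _ (hs v hv)

theorem comp_locallyLipschitz {V : Type*} [SeminormedAddCommGroup V] {f : ℝ → V}
    (hf : AbsolutelyContinuousOnInterval f a b) {G : V → Y} (hG : LocallyLipschitz G) : AbsolutelyContinuousOnInterval (G ∘ f) a b := by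
  have hK : IsCompact (f '' Set.uIcc a b) := isCompact_uIcc.image_of_continuousOn hf.continuousOn
  obtain ⟨C, hC⟩ := LocallyLipschitzOn.exists_lipschitzOnWith_of_compact hK hG.locallyLipschitzOn
  exact hf.comp_lipschitzOnWith hC fun t ht => ⟨t, ht, rfl⟩

theorem comp_contDiffOn_Ioi {f : ℝ → ℝ} (hf : AbsolutelyContinuousOnInterval f a b)
    {G : ℝ → ℝ} {p : ℝ} (hG : ContDiffOn ℝ 1 G (Set.Ioi p)) (hp : ∀ t ∈ Set.uIcc a b, p < f t) :
    AbsolutelyContinuousOnInterval (G ∘ f) a b := by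
  obtain ⟨u, hu, hmin⟩ := isCompact_uIcc.exists_isMinOn Set.nonempty_uIcc hf.continuousOn
  obtain ⟨v, hv, hmax⟩ := isCompact_uIcc.exists_isMaxOn Set.nonempty_uIcc hf.continuousOn
  obtain ⟨C, hC⟩ := (hG.mono (show Set.Icc (f u) (f v) ⊆ Set.Ioi p from
    fun x hx => (hp u hu).trans_le hx.1)).exists_lipschitzOnWith one_ne_zero (convex_Icc _ _)
      isCompact_Icc
  exact hf.comp_lipschitzOnWith hC fun t ht => ⟨hmin ht, hmax ht⟩

/-- The bound is asked only of derivatives that exist; absolute continuity supplies them almost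
everywhere and recovers `f` from them. -/
theorem sub_le_integral {f q : ℝ → ℝ} (hab : a ≤ b) (hf : AbsolutelyContinuousOnInterval f a b)
    (hq : IntervalIntegrable q volume a b)
    (h : ∀ᵐ t, t ∈ Set.Icc a b → ∀ f', HasDerivAt f f' t → f' ≤ q t) :
    f b - f a ≤ ∫ t in a..b, q t := by
  rw [← hf.integral_deriv_eq_sub]
  refine intervalIntegral.integral_mono_ae_restrict hab hf.intervalIntegrable_deriv hq ?_
  rw [EventuallyLE, ae_restrict_iff' measurableSet_Icc]
  filter_upwards [h, hf.ae_differentiableAt] with t ht hd htI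
  exact ht htI _ (hd (Set.Icc_subset_uIcc htI)).hasDerivAt

theorem abs_sub_le_integral {f q : ℝ → ℝ} (hab : a ≤ b)
    (hf : AbsolutelyContinuousOnInterval f a b) (hq : IntervalIntegrable q volume a b)
    (h : ∀ᵐ t, t ∈ Set.Icc a b → ∀ f', HasDerivAt f f' t → |f'| ≤ q t) :
    |f b - f a| ≤ ∫ t in a..b, q t := by
  refine abs_le'.2 ⟨hf.sub_le_integral hab hq ?_, ?_⟩
  · filter_upwards [h] with t ht htI f' hf' using (le_abs_self _).trans (ht htI f' hf')
  · have := hf.neg.sub_le_integral hab hq ?_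
    · simp only [Pi.neg_apply] at this
      linarith
    · filter_upwards [h] with t ht htI f' hf'
      have := ht htI _ (by simpa using hf'.neg)
      rw [abs_neg] at this
      exact (le_abs_self _).trans this

end AbsolutelyContinuousOnInterval

/-- Increments of `θ` are dominated by those of the primitive of `‖v‖`, a real absolutely continuous
function. -/
theorem IsArc.absolutelyContinuousOnInterval {E : Type*} [NormedAddCommGroup E]
    [InnerProductSpace ℝ E] {θ : ℝ → E} (hθ : IsArc θ) {s t : ℝ} (hs : 0 ≤ s) (ht : 0 ≤ t) :
    AbsolutelyContinuousOnInterval θ s t := by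
  obtain ⟨v, hv, hθv⟩ := hθ
  set T := max s t
  have hT : 0 ≤ T := hs.trans (le_max_left _ _)
  have hsub : Set.uIcc s t ⊆ Set.uIcc 0 T := by
    rw [Set.uIcc_of_le hT]
    exact Set.uIcc_subset_Icc ⟨hs, le_max_left _ _⟩ ⟨ht, le_max_right _ _⟩
  have hV := ((hv T hT).norm.absolutelyContinuousOnInterval_intervalIntegral
    (c := 0) Set.left_mem_uIcc).mono hsub
  refine hV.of_dist_le (C := 1) fun p hp q hq => ?_
  have hmem : ∀ p ∈ Set.uIcc s t, 0 ≤ p := fun p hp => by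
    have := hsub hp
    rw [Set.uIcc_of_le hT] at this
    exact this.1
  have hp0 := hmem p hp
  have hq0 := hmem q hq
  rw [one_mul, dist_comm, dist_comm (∫ v in (0 : ℝ)..p, _), hθv p hp0, hθv q hq0,
    dist_add_left, dist_eq_norm, Real.dist_eq,
    intervalIntegral.integral_interval_sub_left (hv q hq0) (hv p hp0),
    intervalIntegral.integral_interval_sub_left (hv q hq0).norm (hv p hp0).norm]
  exact intervalIntegral.norm_integral_le_abs_integral_norm

/-! ### Exponentially weighted averages of slowly varying functions -/

/-- If the relative variation of `g` with respect to a positive scale `B` over bounded time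
windows tends to `0`, then the exponential moving average of `g` is asymptotic to `g`. -/
theorem tendsto_norm_momentum_sub_div {E : Type*} [NormedAddCommGroup E] [NormedSpace ℝ E]
    [CompleteSpace E] {c : ℝ} (hc : 0 < c) {g m : ℝ → E} {B : ℝ → ℝ} {M : ℝ}
    (hgi : ∀ T, 0 ≤ T → IntervalIntegrable g volume 0 T)
    (hgb : ∀ T, 0 ≤ T → ∃ C, ∀ s ∈ Set.Icc 0 T, ‖g s‖ ≤ C)
    (hm : ∀ t, 0 ≤ t → m t = ∫ s in (0 : ℝ)..t, (c * Real.exp (-c * (t - s))) • g s)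
    (hB : ∀ᶠ t in atTop, 0 < B t) (hgB : ∀ᶠ t in atTop, ‖g t‖ ≤ M * B t)
    (hvar : ∀ ε > 0, ∀ᶠ s in atTop, ∀ t ≥ s, ‖g s - g t‖ ≤ ε * Real.exp (c / 2 * (t - s)) * B t)
    (hBvar : ∀ᶠ s in atTop, ∀ t ≥ s, B s ≤ Real.exp (c / 4 * (t - s)) * B t) :
    Tendsto (fun t => ‖m t - g t‖ / B t) atTop (𝓝 0) := by
  have key : ∀ ε > 0, ∃ T C, 0 < B T ∧ ∀ t ≥ T, 0 < B t ∧
      ‖m t - g t‖ / B t ≤ 2 * ε + (2 * (C / B T) * Real.exp (-(c / 4) * (t - T)) +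
        2 * M * Real.exp (-(c / 2) * (t - T)) + M * Real.exp (-c * t)) := by
    intro ε hε
    obtain ⟨T, hT⟩ := eventually_atTop.1
      ((hB.and (hgB.and ((hvar ε hε).and hBvar))).and (eventually_ge_atTop 0))
    have hT0 : 0 ≤ T := (hT T le_rfl).2
    obtain ⟨C, hC⟩ := hgb T hT0
    refine ⟨T, C, (hT T le_rfl).1.1, fun t ht => ?_⟩
    have ht0 : 0 ≤ t := hT0.trans ht
    have hBt : 0 < B t := (hT t ht).1.1
    have hBT : 0 < B T := (hT T le_rfl).1.1
    have hgt : ‖g t‖ ≤ M * B t := (hT t ht).1.2.1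
    have hC0 : 0 ≤ C := (norm_nonneg _).trans (hC 0 ⟨le_rfl, hT0⟩)
    have hMB : 0 ≤ M * B t := (norm_nonneg _).trans hgt
    refine ⟨hBt, ?_⟩
    -- The first term serves `s ≤ T`, where only a crude bound is available but `exp (c / 2 * (t -
    -- s))` exceeds the inverse of its decay factor; the second serves `s ≥ T`.
    set Q := (C + M * B t) * Real.exp (-(c / 2) * (t - T)) + ε * B t with hQ
    have hQ0 : 0 ≤ Q := by positivity
    have hpt : ∀ s ∈ Set.Icc 0 t, ‖g s - g t‖ ≤ Real.exp (c / 2 * (t - s)) * Q := by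
      intro s hs
      rcases le_total s T with hsT | hsT
      · have h1 : 1 ≤ Real.exp (c / 2 * (T - s)) :=
          Real.one_le_exp (mul_nonneg (by positivity) (by linarith))
        have h2 : Real.exp (c / 2 * (t - s)) * Real.exp (-(c / 2) * (t - T)) =
            Real.exp (c / 2 * (T - s)) := by rw [← Real.exp_add]; congr 1; ring
        calc ‖g s - g t‖ ≤ C + M * B t :=
              (norm_sub_le _ _).trans (add_le_add (hC s ⟨hs.1, hsT⟩) hgt)
          _ ≤ (C + M * B t) * Real.exp (c / 2 * (T - s)) :=
              le_mul_of_one_le_right (by positivity) h1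
          _ ≤ (C + M * B t) * Real.exp (c / 2 * (T - s)) +
              Real.exp (c / 2 * (t - s)) * (ε * B t) := le_add_of_nonneg_right (by positivity)
          _ = _ := by rw [hQ, ← h2]; ring
      · calc ‖g s - g t‖ ≤ ε * Real.exp (c / 2 * (t - s)) * B t := (hT s hsT).1.2.2.1 t hs.2
          _ = Real.exp (c / 2 * (t - s)) * (ε * B t) := by ring
          _ ≤ _ := by
            gcongr
            exact le_add_of_nonneg_left (by positivity)
    have hkc : ∀ r : ℝ, Continuous fun s : ℝ => c * Real.exp (-r * (t - s)) := fun r => by fun_prop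
    have hki : ∀ r : ℝ, 0 < r → ∫ s in (0 : ℝ)..t, c * Real.exp (-r * (t - s)) =
        c / r * (1 - Real.exp (-r * t)) := by
      intro r hr
      have hd : ∀ s ∈ Set.uIcc 0 t, HasDerivAt (fun s => c / r * Real.exp (-r * (t - s)))
          (c * Real.exp (-r * (t - s))) s := by
        intro s _
        have h1 : HasDerivAt (fun s : ℝ => -r * (t - s)) r s := by
          simpa using ((hasDerivAt_id s).const_sub t).const_mul (-r)
        refine (h1.exp.const_mul (c / r)).congr_deriv ?_
        field_simp
      rw [intervalIntegral.integral_eq_sub_of_hasDerivAt hd ((hkc r).intervalIntegrable _ _)]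
      simp
      ring
    have hgi' : IntervalIntegrable (fun s => (c * Real.exp (-c * (t - s))) • g s) volume 0 t :=
      (hgi t ht0).continuousOn_smul (hkc c).continuousOn
    have hci : IntervalIntegrable (fun s => (c * Real.exp (-c * (t - s))) • g t) volume 0 t :=
      ((hkc c).smul continuous_const).intervalIntegrable _ _
    -- The kernel has mass `1 - exp (-c * t)`, whence the extra term in `g t`.
    have hrep : m t - g t = (∫ s in (0 : ℝ)..t, (c * Real.exp (-c * (t - s))) • (g s - g t)) -
        Real.exp (-c * t) • g t := by
      simp only [smul_sub]
      rw [intervalIntegral.integral_sub hgi' hci, ← hm t ht0,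
        intervalIntegral.integral_smul_const, hki c hc, div_self hc.ne', one_mul, sub_smul,
        one_smul]
      abel
    have hint : ‖∫ s in (0 : ℝ)..t, (c * Real.exp (-c * (t - s))) • (g s - g t)‖ ≤ 2 * Q := by
      calc _ ≤ ∫ s in (0 : ℝ)..t, c * Real.exp (-(c / 2) * (t - s)) * Q := by
            refine intervalIntegral.norm_integral_le_of_norm_le ht0
              (ae_of_all _ fun s hs => ?_)
              (((hkc _).mul continuous_const).intervalIntegrable _ _)
            rw [norm_smul, Real.norm_of_nonneg (by positivity)]
            calc _ ≤ c * Real.exp (-c * (t - s)) * (Real.exp (c / 2 * (t - s)) * Q) := by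
                  gcongr
                  exact hpt s (Set.Ioc_subset_Icc_self hs)
              _ = c * (Real.exp (-c * (t - s)) * Real.exp (c / 2 * (t - s))) * Q := by ring
              _ = _ := by
                rw [← Real.exp_add]
                congr 3
                ring
        _ = 2 * (1 - Real.exp (-(c / 2) * t)) * Q := by
            rw [intervalIntegral.integral_mul_const, hki _ (by positivity)]
            field_simp
        _ ≤ 2 * 1 * Q := by
            gcongr
            linarith [Real.exp_pos (-(c / 2) * t)]
        _ = 2 * Q := by ring
    -- `B` may decay, but no faster than `exp (-(c / 4) * t)`, so the constant `C` times `exp (-(c /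
    -- 2) * (t - T))` stays negligible against `B t`.
    have hCB : C ≤ C / B T * (Real.exp (c / 4 * (t - T)) * B t) := by
      rw [div_mul_eq_mul_div, le_div_iff₀ hBT]
      gcongr
      exact (hT T le_rfl).1.2.2.2 t ht
    rw [div_le_iff₀ hBt, hrep]
    refine (norm_sub_le _ _).trans ?_
    rw [norm_smul, Real.norm_of_nonneg (Real.exp_pos _).le]
    calc _ ≤ 2 * Q + Real.exp (-c * t) * (M * B t) := by gcongr
      _ = 2 * (C * Real.exp (-(c / 2) * (t - T))) +
          2 * (M * B t * Real.exp (-(c / 2) * (t - T)) + ε * B t) +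
          Real.exp (-c * t) * (M * B t) := by rw [hQ]; ring
      _ ≤ 2 * (C / B T * (Real.exp (c / 4 * (t - T)) * B t) * Real.exp (-(c / 2) * (t - T))) +
          2 * (M * B t * Real.exp (-(c / 2) * (t - T)) + ε * B t) +
          Real.exp (-c * t) * (M * B t) := by gcongr
      _ = 2 * (C / B T) * (Real.exp (c / 4 * (t - T)) * Real.exp (-(c / 2) * (t - T))) * B t +
          2 * (M * B t * Real.exp (-(c / 2) * (t - T)) + ε * B t) +
          Real.exp (-c * t) * (M * B t) := by ring
      _ = _ := by
        rw [← Real.exp_add, show c / 4 * (t - T) + -(c / 2) * (t - T) = -(c / 4) * (t - T) by ring]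
        ring
  have hexp : ∀ r : ℝ, 0 < r → ∀ T : ℝ,
      Tendsto (fun t => Real.exp (-r * (t - T))) atTop (𝓝 0) := fun r hr T =>
    Real.tendsto_exp_atBot.comp
      ((tendsto_atTop_add_const_right atTop (-T) tendsto_id).const_mul_atTop_of_neg (by linarith))
  rw [tendsto_order]
  constructor
  · intro a ha
    filter_upwards [hB] with t ht
    exact ha.trans_le (by positivity)
  · intro a ha
    obtain ⟨T, C, -, hT⟩ := key (a / 4) (by positivity)
    have hlim : Tendsto (fun t => 2 * (C / B T) * Real.exp (-(c / 4) * (t - T)) +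
        2 * M * Real.exp (-(c / 2) * (t - T)) + M * Real.exp (-c * t)) atTop (𝓝 0) := by
      simpa using (((hexp (c / 4) (by positivity) T).const_mul (2 * (C / B T))).add
        ((hexp (c / 2) (by positivity) T).const_mul (2 * M))).add ((hexp c hc 0).const_mul M)
    filter_upwards [eventually_ge_atTop T, hlim.eventually (gt_mem_nhds (half_pos ha))] with t h1 h2
    linarith [(hT t h1).2]

/-! ### Exponentially tailed losses -/

namespace IsLogConcaveExpTailed

variable {φ : ℝ → ℝ}

theorem differentiable (hφ : IsLogConcaveExpTailed φ) : Differentiable ℝ φ :=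
  hφ.contDiff.differentiable two_ne_zero

theorem contDiff_deriv (hφ : IsLogConcaveExpTailed φ) : ContDiff ℝ 1 (deriv φ) :=
  ContDiff.deriv' (one_add_one_eq_two (R := WithTop ℕ∞) ▸ hφ.contDiff)

theorem monotone_deriv (hφ : IsLogConcaveExpTailed φ) : Monotone (deriv φ) :=
  monotone_of_deriv_nonneg (hφ.contDiff_deriv.differentiable one_ne_zero) hφ.deriv2_nonneg

theorem strictMono (hφ : IsLogConcaveExpTailed φ) : StrictMono φ :=
  strictMono_of_deriv_pos hφ.deriv_pos

/-- The limit of `φ'` at infinity. -/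
theorem exists_tendsto_deriv (hφ : IsLogConcaveExpTailed φ) :
    ∃ p, 0 < p ∧ Tendsto (deriv φ) atTop (𝓝 p) ∧ ∀ u, deriv φ u ≤ p := by
  obtain ⟨C, hC⟩ := hφ.deriv_bdd
  have hb : BddAbove (Set.range (deriv φ)) := ⟨C, by rintro _ ⟨u, rfl⟩; exact hC u⟩
  exact ⟨_, (hφ.deriv_pos 0).trans_le (le_ciSup hb 0),
    tendsto_atTop_ciSup hφ.monotone_deriv hb, le_ciSup hb⟩

theorem le_add_mul (hφ : IsLogConcaveExpTailed φ) {p u : ℝ} (hp : ∀ u, deriv φ u ≤ p)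
    (hu : 0 ≤ u) : φ u ≤ φ 0 + p * u := by
  have := image_sub_le_mul_sub_of_deriv_le hφ.differentiable hp hu
  linarith

/-- The logarithm of `exp (-φ) φ'` is Lipschitz on `[0, ∞)`. -/
theorem exists_abs_log_sub_le (hφ : IsLogConcaveExpTailed φ) : ∃ C, ∀ u v, 0 ≤ u → 0 ≤ v →
    |Real.log (Real.exp (-φ u) * deriv φ u) - Real.log (Real.exp (-φ v) * deriv φ v)| ≤
      C * |u - v| := by
  obtain ⟨B₁, h₁⟩ := hφ.deriv_bdd
  obtain ⟨B₂, h₂⟩ := hφ.deriv2_bdd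
  have hd0 := hφ.deriv_pos 0
  -- `B₁` is the slope bound for `φ`; `B₂ / deriv φ 0` bounds the slope `φ'' / φ'` of `log φ'`, as
  -- `φ' ≥ φ' 0` on `[0, ∞)`.
  refine ⟨B₁ + B₂ / deriv φ 0, fun u v hu hv => ?_⟩
  wlog huv : u ≤ v generalizing u v
  · rw [abs_sub_comm, abs_sub_comm u]
    exact this v u hv hu (le_of_not_ge huv)
  have hB₂ : 0 ≤ B₂ := (hφ.deriv2_nonneg 0).trans (h₂ 0)
  have e1 := image_sub_le_mul_sub_of_deriv_le hφ.differentiable h₁ huv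
  have e2 := hφ.strictMono.monotone huv
  have e3 := image_sub_le_mul_sub_of_deriv_le (hφ.contDiff_deriv.differentiable one_ne_zero)
    h₂ huv
  have hpu := hφ.deriv_pos u
  have hpv := hφ.deriv_pos v
  have e4 : Real.log (deriv φ v) - Real.log (deriv φ u) ≤ B₂ / deriv φ 0 * (v - u) := by
    rw [← Real.log_div hpv.ne' hpu.ne']
    refine (Real.log_le_sub_one_of_pos (div_pos hpv hpu)).trans ?_
    rw [div_sub_one hpu.ne', div_mul_eq_mul_div]
    exact div_le_div₀ (by nlinarith) e3 hd0 (hφ.monotone_deriv hu)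
  have e5 := Real.log_le_log hpu (hφ.monotone_deriv huv)
  rw [Real.log_mul (Real.exp_pos _).ne' hpu.ne', Real.log_mul (Real.exp_pos _).ne' hpv.ne',
    Real.log_exp, Real.log_exp, abs_sub_comm u, abs_of_nonneg (sub_nonneg.2 huv), abs_le]
  constructor <;> nlinarith [mul_nonneg (div_nonneg hB₂ hd0.le) (sub_nonneg.2 huv)]

end IsLogConcaveExpTailed

/-! ### Learning rate schedules -/

theorem IsMSDSchedule.tendsto_zero {η : ℝ → ℝ} {L : ℝ} (h : IsMSDSchedule η L) (hL : 1 ≤ L) :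
    Tendsto η atTop (𝓝 0) := by
  have h1 : η =o[atTop] fun _ : ℝ => (1 : ℝ) := by
    refine h.isLittleO.trans_isBigO (Asymptotics.IsBigO.of_bound 1 ?_)
    filter_upwards [eventually_ge_atTop 1] with t ht
    rw [Real.norm_of_nonneg (by positivity), norm_one, mul_one]
    refine Real.rpow_le_one_of_one_le_of_nonpos ht ?_
    rw [sub_nonpos, div_le_one (by linarith)]
    exact hL
  simpa using h1.tendsto_div_nhds_zero

/-- A function growing at most like `∫ η` satisfies `N ^ (L - 1) η → 0`. -/
theorem IsMSDSchedule.tendsto_rpow_mul_zero {η N : ℝ → ℝ} {L : ℝ} (h : IsMSDSchedule η L)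
    (hL : 1 ≤ L) (hη : ∀ t, 0 ≤ t → 0 < η t) (hN0 : ∀ t, 0 ≤ N t)
    (hN : ∀ s t, 0 ≤ s → s ≤ t → N t - N s ≤ ∫ x in s..t, η x) :
    Tendsto (fun t => N t ^ (L - 1) * η t) atTop (𝓝 0) := by
  have hL0 : 0 < L := by linarith
  obtain ⟨T, hT⟩ := eventually_atTop.1
    ((h.isLittleO.bound one_pos).and (eventually_ge_atTop 1))
  have hT1 : 1 ≤ T := (hT T le_rfl).2
  -- Integrating `η ≤ x ^ (1 / L - 1)` gives growth of order `t ^ (1 / L)`. Its power `L - 1` is the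
  -- reciprocal of `t ^ (1 / L - 1)`, exactly what the schedule beats.
  have hbound : ∀ t ≥ T, N t ≤ (N T + L) * t ^ (1 / L) := by
    intro t ht
    have ht1 : 1 ≤ t := hT1.trans ht
    have h1 := hN T t (by linarith) ht
    have hint : IntervalIntegrable (fun x : ℝ => x ^ (1 / L - 1)) volume T t :=
      intervalIntegral.intervalIntegrable_rpow' (by
        have : 0 < 1 / L := by positivity
        linarith)
    have h2 : ∫ x in T..t, η x ≤ ∫ x in T..t, x ^ (1 / L - 1) := by
      refine intervalIntegral.integral_mono_on ht ?_ hint fun x hx => ?_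
      · exact ((h.integrable T (by linarith)).symm.trans (h.integrable t (by linarith)))
      · have hx1 : 1 ≤ x := hT1.trans hx.1
        have := (hT x hx.1).1
        rw [one_mul, Real.norm_of_nonneg (show 0 ≤ x ^ (1 / L - 1) by positivity)] at this
        exact (le_abs_self _).trans this
    rw [integral_rpow (Or.inl (by
        have : 0 < 1 / L := by positivity
        linarith)), sub_add_cancel] at h2
    have h3 : (t ^ (1 / L) - T ^ (1 / L)) / (1 / L) ≤ L * t ^ (1 / L) := by
      rw [div_div_eq_mul_div, div_one, mul_comm]
      gcongr
      have : 0 ≤ T ^ (1 / L) := by positivity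
      linarith
    have h4 : 1 ≤ t ^ (1 / L) := Real.one_le_rpow ht1 (by positivity)
    nlinarith [hN0 T]
  set D := N T + L
  have hD : 0 ≤ D := by have := hN0 T; positivity
  have hη0 : Tendsto (fun t => D ^ (L - 1) * (η t / t ^ (1 / L - 1))) atTop (𝓝 0) := by
    simpa using h.isLittleO.tendsto_div_nhds_zero.const_mul (D ^ (L - 1))
  refine squeeze_zero' ?_ ?_ hη0
  · filter_upwards [eventually_ge_atTop 0] with t ht
    have := hη t ht
    have := hN0 t
    positivity
  · filter_upwards [eventually_ge_atTop T] with t ht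
    have ht0 : 0 < t := by linarith
    have hηt := hη t ht0.le
    calc N t ^ (L - 1) * η t ≤ (D * t ^ (1 / L)) ^ (L - 1) * η t := by
          gcongr
          · exact hN0 t
          · exact hbound t ht
      _ = D ^ (L - 1) * (η t * t ^ (1 / L * (L - 1))) := by
          rw [Real.mul_rpow hD (by positivity), ← Real.rpow_mul ht0.le]
          ring
      _ = D ^ (L - 1) * (η t / t ^ (1 / L - 1)) := by
          rw [show 1 / L * (L - 1) = -(1 / L - 1) by field_simp; ring, Real.rpow_neg ht0.le,
            ← div_eq_mul_inv]

theorem abs_exp_sub_one_le_mul_exp (x : ℝ) : |Real.exp x - 1| ≤ |x| * Real.exp |x| := by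
  rcases le_total 0 x with hx | hx
  · rw [abs_of_nonneg hx, abs_of_nonneg (by linarith [Real.one_le_exp hx])]
    have h := mul_le_mul_of_nonneg_right (Real.add_one_le_exp (-x)) (Real.exp_pos x).le
    rw [← Real.exp_add, neg_add_cancel, Real.exp_zero] at h
    linarith
  · rw [abs_of_nonpos hx, abs_of_nonpos (by linarith [Real.exp_le_one_iff.2 hx])]
    have := Real.add_one_le_exp x
    have := Real.one_le_exp (neg_nonneg.2 hx)
    nlinarith

/-- Exponential comparison for a positive function whose logarithm varies slowly. -/
theorem exp_bounds_of_abs_log_sub_le {p q a ε τ : ℝ} (hp : 0 < p) (hq : 0 < q) (ha : 0 < a)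
    (hε : 0 ≤ ε) (hεa : ε ≤ a) (hτ : 0 ≤ τ) (h : |Real.log p - Real.log q| ≤ ε * τ) :
    p ≤ Real.exp (a * τ) * q ∧ |p - q| ≤ ε / a * Real.exp (2 * a * τ) * q := by
  set x := Real.log p - Real.log q
  have hpx : p = Real.exp x * q := by
    rw [Real.exp_sub, Real.exp_log hp, Real.exp_log hq, div_mul_cancel₀ _ hq.ne']
  have hxa : |x| ≤ a * τ := h.trans (by gcongr)
  constructor
  · rw [hpx]
    gcongr
    exact (le_abs_self x).trans hxa
  · have h1 : p - q = (Real.exp x - 1) * q := by rw [hpx]; ring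
    rw [h1, abs_mul, abs_of_pos hq]
    gcongr
    -- The linear factor `ε * τ` is traded for a second exponential through `a * τ ≤ exp (a * τ)`,
    -- which leaves the small constant `ε / a`.
    calc |Real.exp x - 1| ≤ |x| * Real.exp |x| := abs_exp_sub_one_le_mul_exp x
      _ ≤ ε * τ * Real.exp (a * τ) := by gcongr
      _ = ε / a * (a * τ) * Real.exp (a * τ) := by field_simp
      _ ≤ ε / a * Real.exp (a * τ) * Real.exp (a * τ) := by
          gcongr
          linarith [Real.add_one_le_exp (a * τ)]
      _ = ε / a * Real.exp (2 * a * τ) := by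
          rw [mul_assoc, ← Real.exp_add]
          ring_nf

theorem abs_le_norm_of_hasDerivAt_norm {V : Type*} [NormedAddCommGroup V] [NormedSpace ℝ V]
    {γ : ℝ → V} {w : V} {r t : ℝ} (hw : HasDerivAt γ w t)
    (hr : HasDerivAt (fun s => ‖γ s‖) r t) : |r| ≤ ‖w‖ := by
  refine le_of_tendsto_of_tendsto (hasDerivAt_iff_tendsto_slope.1 hr).abs
    (hasDerivAt_iff_tendsto_slope.1 hw).norm (Eventually.of_forall fun s => ?_)
  simp only [slope, vsub_eq_sub, smul_eq_mul, abs_mul, norm_smul, Real.norm_eq_abs]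
  gcongr
  exact abs_norm_sub_norm_le _ _

/-! ### Momentum steepest descent along a curve converging in direction -/

section MarginFlow

variable {E : Type*} [NormedAddCommGroup E] [InnerProductSpace ℝ E]
  {F : Type*} [NormedAddCommGroup F] [NormedSpace ℝ F] {ι : Type*} [Fintype ι]

/-- A curve `θ` following normalized momentum steepest descent for the norm `x ↦ ‖A x‖` and the
loss `∑ᵢ exp (-φ zᵢ)`, expressed through the margins `z i t` and their subgradients `H i t`, in the
regime where `θ` converges in direction to `θbar`, the margins are asymptotic to
`γ i * ‖A (θ t)‖ ^ L` and the normalized subgradients converge to `l i`. -/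
structure IsMarginFlow (A : E →L[ℝ] F) (φ : ℝ → ℝ) (c L : ℝ) (η : ℝ → ℝ) (θ g m : ℝ → E)
    (θbar : E) (z : ι → ℝ → ℝ) (H : ι → ℝ → E) (l : ι → E) (γ : ι → ℝ) : Prop where
  tailed : IsLogConcaveExpTailed φ
  c_pos : 0 < c
  one_le : 1 ≤ L
  rate_pos : ∀ t, 0 ≤ t → 0 < η t
  schedule : IsMSDSchedule η L
  bound : ∃ C, 0 ≤ C ∧ ∀ v, ‖v‖ ≤ C * ‖A v‖
  curve_ac : ∀ s t, 0 ≤ s → 0 ≤ t → AbsolutelyContinuousOnInterval θ s t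
  nontrivial : ∃ p, 0 < p ∧ ∀ᶠ t in atTop, p ≤ ‖A (θ t)‖
  norm_dir : ‖A θbar‖ = 1
  -- The inequality `‖A u‖ ≤ 1` also covers times with `m t = 0`, where Muon's direction vanishes.
  -- Here `u` maximizes and the velocity is `-η u`.
  step : ∀ᵐ t, 0 ≤ t → ∃ u, ‖A u‖ ≤ 1 ∧ (∀ v, ‖A v‖ ≤ 1 → inner ℝ v (m t) ≤ inner ℝ u (m t)) ∧
    HasDerivAt θ (-(η t • u)) t
  margin_ac : ∀ i s t, 0 ≤ s → 0 ≤ t → AbsolutelyContinuousOnInterval (z i) s t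
  chain : ∀ᵐ t, 0 ≤ t → ∀ i w r, HasDerivAt θ w t → HasDerivAt (z i) r t → inner ℝ (H i t) w = r
  grad_eq : ∀ t, 0 ≤ t → g t = -∑ i, (Real.exp (-φ (z i t)) * deriv φ (z i t)) • H i t
  tendsto_subgrad : ∀ i, Tendsto (fun t => (‖A (θ t)‖ ^ (L - 1))⁻¹ • H i t) atTop (𝓝 (l i))
  tendsto_margin : ∀ i, Tendsto (fun t => z i t / ‖A (θ t)‖ ^ L) atTop (𝓝 (γ i))
  margin_pos : ∀ i, 0 < γ i
  euler : ∀ i, inner ℝ (l i) θbar = L * γ i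
  grad_integrable : ∀ T, 0 ≤ T → IntervalIntegrable g volume 0 T
  grad_bdd : ∀ T, 0 ≤ T → ∃ C, ∀ s ∈ Set.Icc 0 T, ‖g s‖ ≤ C
  momentum : ∀ t, 0 ≤ t → m t = ∫ s in (0 : ℝ)..t, (c * Real.exp (-c * (t - s))) • g s

/-- The weight of a margin in the gradient of the loss. -/
noncomputable def lossWeight (φ : ℝ → ℝ) (u : ℝ) : ℝ := Real.exp (-φ u) * deriv φ u

theorem IsLogConcaveExpTailed.lossWeight_pos {φ : ℝ → ℝ} (hφ : IsLogConcaveExpTailed φ) (u : ℝ) :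
    0 < lossWeight φ u :=
  mul_pos (Real.exp_pos _) (hφ.deriv_pos u)

/-! ### Slow variation of norm and margins; the momentum tracks the gradient -/

namespace IsMarginFlow

variable {A : E →L[ℝ] F} {φ : ℝ → ℝ} {c L : ℝ} {η : ℝ → ℝ} {θ g m : ℝ → E}
  {θbar : E} {z : ι → ℝ → ℝ} {H : ι → ℝ → E} {l : ι → E} {γ : ι → ℝ}

theorem norm_ac (h : IsMarginFlow A φ c L η θ g m θbar z H l γ) {s t : ℝ} (hs : 0 ≤ s)
    (ht : 0 ≤ t) : AbsolutelyContinuousOnInterval (fun x => ‖A (θ x)‖) s t :=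
  (h.curve_ac s t hs ht).comp_lipschitzOnWith
    (lipschitzWith_one_norm.comp A.lipschitz).lipschitzOnWith fun _ _ => Set.mem_univ _

theorem rate_integrable (h : IsMarginFlow A φ c L η θ g m θbar z H l γ) {s t : ℝ} (hs : 0 ≤ s)
    (ht : 0 ≤ t) : IntervalIntegrable η volume s t :=
  (h.schedule.integrable s hs).symm.trans (h.schedule.integrable t ht)

theorem ae_abs_deriv_norm_le (h : IsMarginFlow A φ c L η θ g m θbar z H l γ) :
    ∀ᵐ t, 0 ≤ t → ∀ r, HasDerivAt (fun x => ‖A (θ x)‖) r t → |r| ≤ η t := by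
  filter_upwards [h.step] with t ht ht0 r hr
  obtain ⟨u, hu, -, hd⟩ := ht ht0
  refine (abs_le_norm_of_hasDerivAt_norm (A.hasFDerivAt.comp_hasDerivAt t hd) hr).trans ?_
  have := (h.rate_pos t ht0).le
  rw [map_neg, norm_neg, map_smul, norm_smul, Real.norm_of_nonneg this]
  exact mul_le_of_le_one_right this hu

theorem abs_norm_sub_le (h : IsMarginFlow A φ c L η θ g m θbar z H l γ) {s t : ℝ} (hs : 0 ≤ s)
    (hst : s ≤ t) : |‖A (θ t)‖ - ‖A (θ s)‖| ≤ ∫ x in s..t, η x := by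
  refine (h.norm_ac hs (hs.trans hst)).abs_sub_le_integral hst
    (h.rate_integrable hs (hs.trans hst)) ?_
  filter_upwards [h.ae_abs_deriv_norm_le] with x hx hxI r hr using hx (hs.trans hxI.1) r hr

/-- Up to a constant this quantity bounds the speed of every margin. -/
theorem tendsto_scale_mul_rate (h : IsMarginFlow A φ c L η θ g m θbar z H l γ) :
    Tendsto (fun t => ‖A (θ t)‖ ^ (L - 1) * η t) atTop (𝓝 0) :=
  h.schedule.tendsto_rpow_mul_zero h.one_le h.rate_pos (fun _ => norm_nonneg _)
    fun _ _ hs hst => (le_abs_self _).trans (h.abs_norm_sub_le hs hst)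

theorem norm_slowly_varying (h : IsMarginFlow A φ c L η θ g m θbar z H l γ) {ε : ℝ} (hε : 0 < ε) :
    ∀ᶠ s in atTop, ∀ t ≥ s, |‖A (θ s)‖ - ‖A (θ t)‖| ≤ ε * (t - s) := by
  have h1 := ((h.schedule.tendsto_zero h.one_le).eventually (gt_mem_nhds hε)).and
    (eventually_ge_atTop 0)
  filter_upwards [eventually_forall_ge_atTop.2 h1] with s hs t hst
  have hs0 := (hs s le_rfl).2
  rw [abs_sub_comm]
  refine (h.abs_norm_sub_le hs0 hst).trans ?_
  calc ∫ x in s..t, η x ≤ ∫ _ in s..t, ε :=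
        intervalIntegral.integral_mono_on hst (h.rate_integrable hs0 (hs0.trans hst))
          (by simp) fun x hx => (hs x hx.1).1.le
    _ = ε * (t - s) := by simp [mul_comm]

theorem eventually_norm_pos (h : IsMarginFlow A φ c L η θ g m θbar z H l γ) :
    ∀ᶠ t in atTop, 0 < ‖A (θ t)‖ := by
  obtain ⟨p, hp, hev⟩ := h.nontrivial
  filter_upwards [hev] with t ht using hp.trans_le ht

theorem eventually_margin_pos (h : IsMarginFlow A φ c L η θ g m θbar z H l γ) (i : ι) :
    ∀ᶠ t in atTop, 0 < z i t := by
  filter_upwards [(h.tendsto_margin i).eventually (lt_mem_nhds (h.margin_pos i)),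
    h.eventually_norm_pos] with t ht hN
  exact (div_pos_iff_of_pos_right (Real.rpow_pos_of_pos hN L)).1 ht

/-- By the chain rule the speed of `z i` is at most `‖H i‖ * ‖θ'‖`, of order `‖A θ‖ ^ (L - 1) * η`,
which tends to 0. -/
theorem margin_slowly_varying (h : IsMarginFlow A φ c L η θ g m θbar z H l γ) (i : ι) {ε : ℝ}
    (hε : 0 < ε) : ∀ᶠ s in atTop, ∀ t ≥ s, |z i s - z i t| ≤ ε * (t - s) := by
  obtain ⟨C, hC0, hC⟩ := h.bound
  set M := ‖l i‖ + 1
  have hM : 0 < M := by positivity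
  have hlim : Tendsto (fun t => M * C * (‖A (θ t)‖ ^ (L - 1) * η t)) atTop (𝓝 0) := by
    simpa using h.tendsto_scale_mul_rate.const_mul (M * C)
  have h1 := ((hlim.eventually (gt_mem_nhds hε)).and
    ((h.tendsto_subgrad i).norm.eventually (gt_mem_nhds (lt_add_one ‖l i‖)))).and
    ((eventually_ge_atTop 0).and h.eventually_norm_pos)
  filter_upwards [eventually_forall_ge_atTop.2 h1] with s hs t hst
  have hs0 := (hs s le_rfl).2.1
  rw [abs_sub_comm]
  refine ((h.margin_ac i s t hs0 (hs0.trans hst)).abs_sub_le_integral (q := fun _ => ε) hst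
    (by simp) ?_).trans (by simp [mul_comm])
  filter_upwards [h.step, h.chain] with x hx hxc hxI r hr
  obtain ⟨⟨hx1, hx2⟩, hx0, hxN⟩ := hs x hxI.1
  obtain ⟨u, hu, -, hd⟩ := hx hx0
  rw [← hxc hx0 i _ _ hd hr]
  have hη := h.rate_pos x hx0
  have hρ : 0 < ‖A (θ x)‖ ^ (L - 1) := Real.rpow_pos_of_pos hxN _
  rw [norm_smul, norm_inv, Real.norm_of_nonneg hρ.le, inv_mul_lt_iff₀ hρ] at hx2
  refine (abs_real_inner_le_norm _ _).trans (le_trans ?_ hx1.le)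
  rw [norm_neg, norm_smul, Real.norm_of_nonneg hη.le]
  calc ‖H i x‖ * (η x * ‖u‖) ≤ (‖A (θ x)‖ ^ (L - 1) * M) * (η x * (C * 1)) := by
        gcongr
        exact (hC u).trans (by gcongr)
    _ = _ := by ring

/-- The coefficients of the normalized subgradients in the gradient of the loss vary slowly on a
logarithmic scale. -/
theorem log_coeff_slowly_varying (h : IsMarginFlow A φ c L η θ g m θbar z H l γ) (i : ι) {ε : ℝ}
    (hε : 0 < ε) : ∀ᶠ s in atTop, ∀ t ≥ s,
      |Real.log (lossWeight φ (z i s) * ‖A (θ s)‖ ^ (L - 1)) -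
        Real.log (lossWeight φ (z i t) * ‖A (θ t)‖ ^ (L - 1))| ≤ ε * (t - s) := by
  obtain ⟨C, hC⟩ := h.tailed.exists_abs_log_sub_le
  obtain ⟨p, hp, hev⟩ := h.nontrivial
  have hL := h.one_le
  -- Each of the two factors gets `ε / 2`: the log-weight is `C`-Lipschitz in the margin, and `log`
  -- is `1 / p`-Lipschitz on `[p, ∞)`.
  have h1 := (h.margin_slowly_varying i (show 0 < ε / (2 * (|C| + 1)) by positivity)).and
    (h.norm_slowly_varying (show 0 < ε * p / (2 * L) by positivity))
  have h2 := eventually_forall_ge_atTop.2 (hev.and (h.eventually_margin_pos i))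
  filter_upwards [h1, h2] with s hs hs2 t hst
  obtain ⟨hNs, hzs⟩ := hs2 s le_rfl
  obtain ⟨hNt, hzt⟩ := hs2 t hst
  have hNs0 := hp.trans_le hNs
  have hNt0 := hp.trans_le hNt
  have hst0 : 0 ≤ t - s := sub_nonneg.2 hst
  rw [Real.log_mul (h.tailed.lossWeight_pos _).ne' (Real.rpow_pos_of_pos hNs0 _).ne',
    Real.log_mul (h.tailed.lossWeight_pos _).ne' (Real.rpow_pos_of_pos hNt0 _).ne',
    Real.log_rpow hNs0, Real.log_rpow hNt0]
  have e1 : |Real.log (lossWeight φ (z i s)) - Real.log (lossWeight φ (z i t))| ≤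
      ε / 2 * (t - s) := by
    refine (hC _ _ hzs.le hzt.le).trans ?_
    calc C * |z i s - z i t| ≤ (|C| + 1) * (ε / (2 * (|C| + 1)) * (t - s)) := by
          gcongr
          · linarith [le_abs_self C]
          · exact hs.1 t hst
      _ = ε / 2 * (t - s) := by field_simp
  have hlog : ∀ a b : ℝ, p ≤ a → p ≤ b → Real.log a - Real.log b ≤ |a - b| / p := by
    intro a b ha hb
    have ha0 := hp.trans_le ha
    have hb0 := hp.trans_le hb
    rw [← Real.log_div ha0.ne' hb0.ne']
    refine (Real.log_le_sub_one_of_pos (div_pos ha0 hb0)).trans ?_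
    rw [div_sub_one hb0.ne']
    exact div_le_div₀ (abs_nonneg _) (le_abs_self _) hp hb
  have e2 : |Real.log ‖A (θ s)‖ - Real.log ‖A (θ t)‖| ≤ |‖A (θ s)‖ - ‖A (θ t)‖| / p :=
    abs_le'.2 ⟨hlog _ _ hNs hNt, by
      rw [neg_sub, abs_sub_comm]
      exact hlog _ _ hNt hNs⟩
  have e3 : |(L - 1) * Real.log ‖A (θ s)‖ - (L - 1) * Real.log ‖A (θ t)‖| ≤ ε / 2 * (t - s) := by
    rw [← mul_sub, abs_mul, abs_of_nonneg (sub_nonneg.2 hL)]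
    calc (L - 1) * |Real.log ‖A (θ s)‖ - Real.log ‖A (θ t)‖| ≤
          L * (ε * p / (2 * L) * (t - s) / p) := by
          gcongr
          · linarith
          · exact e2.trans (by gcongr; exact hs.2 t hst)
      _ = ε / 2 * (t - s) := by field_simp
  rw [add_sub_add_comm]
  refine (abs_add_le _ _).trans ?_
  linarith

/-- The total coefficient of the normalized subgradients in the gradient of the loss. -/
noncomputable def gradScale (A : E →L[ℝ] F) (φ : ℝ → ℝ) (L : ℝ) (θ : ℝ → E) (z : ι → ℝ → ℝ) (t : ℝ) : ℝ :=
  ∑ i, lossWeight φ (z i t) * ‖A (θ t)‖ ^ (L - 1)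

theorem grad_eq_normalized (h : IsMarginFlow A φ c L η θ g m θbar z H l γ) {t : ℝ} (ht : 0 ≤ t)
    (hN : 0 < ‖A (θ t)‖) : g t = -∑ i, (lossWeight φ (z i t) * ‖A (θ t)‖ ^ (L - 1)) •
      ((‖A (θ t)‖ ^ (L - 1))⁻¹ • H i t) := by
  rw [h.grad_eq t ht]
  congr 1
  refine Finset.sum_congr rfl fun i _ => ?_
  rw [smul_smul, mul_assoc, mul_inv_cancel₀ (Real.rpow_pos_of_pos hN _).ne', mul_one]
  rfl

/-- The momentum is asymptotic to the gradient of the loss. -/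
theorem tendsto_momentum_sub_grad [CompleteSpace E] [Nonempty ι]
    (h : IsMarginFlow A φ c L η θ g m θbar z H l γ) :
    Tendsto (fun t => ‖m t - g t‖ / gradScale A φ L θ z t) atTop (𝓝 0) := by
  set M := 1 + ∑ i, ‖l i‖
  have hM : 0 < M := by positivity
  have hc := h.c_pos
  have hcoef : ∀ i, ∀ᶠ t in atTop, 0 < lossWeight φ (z i t) * ‖A (θ t)‖ ^ (L - 1) := fun i =>
    h.eventually_norm_pos.mono fun t ht =>
      mul_pos (h.tailed.lossWeight_pos _) (Real.rpow_pos_of_pos ht _)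
  have hcoef' := eventually_all.2 hcoef
  have hlM : ∀ᶠ t in atTop, ∀ i, ‖(‖A (θ t)‖ ^ (L - 1))⁻¹ • H i t‖ ≤ M :=
    eventually_all.2 fun i => by
      have : ‖l i‖ < M := by
        have := Finset.single_le_sum (f := fun i => ‖l i‖) (fun j _ => norm_nonneg _)
          (Finset.mem_univ i)
        linarith
      exact ((h.tendsto_subgrad i).norm.eventually (gt_mem_nhds this)).mono fun t ht => ht.le
  -- The comparison rate `c / 4` gives growth `c / 4` for the scale and `c / 2` for the increments,
  -- as the averaging lemma requires.
  have hpair : ∀ δ, 0 < δ → δ ≤ c / 4 → ∀ᶠ s in atTop, ∀ t ≥ s, ∀ i,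
      lossWeight φ (z i s) * ‖A (θ s)‖ ^ (L - 1) ≤
        Real.exp (c / 4 * (t - s)) * (lossWeight φ (z i t) * ‖A (θ t)‖ ^ (L - 1)) ∧
      |lossWeight φ (z i s) * ‖A (θ s)‖ ^ (L - 1) - lossWeight φ (z i t) * ‖A (θ t)‖ ^ (L - 1)| ≤
        δ / (c / 4) * Real.exp (c / 2 * (t - s)) *
          (lossWeight φ (z i t) * ‖A (θ t)‖ ^ (L - 1)) := by
    intro δ hδ hδc
    filter_upwards [eventually_all.2 fun i => h.log_coeff_slowly_varying i hδ,
      eventually_forall_ge_atTop.2 hcoef'] with s hs hs2 t hst i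
    have := exp_bounds_of_abs_log_sub_le (hs2 s le_rfl i) (hs2 t hst i)
      (show 0 < c / 4 by positivity) hδ.le hδc (sub_nonneg.2 hst) (hs i t hst)
    rwa [show 2 * (c / 4) = c / 2 by ring] at this
  refine tendsto_norm_momentum_sub_div (M := M) hc h.grad_integrable h.grad_bdd h.momentum ?_ ?_
    ?_ ?_
  · filter_upwards [hcoef'] with t ht
    exact Finset.sum_pos (fun i _ => ht i) Finset.univ_nonempty
  · filter_upwards [hcoef', hlM, eventually_ge_atTop 0, h.eventually_norm_pos] with t h1 h2 h3 h4
    rw [h.grad_eq_normalized h3 h4, norm_neg, gradScale, Finset.mul_sum]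
    refine norm_sum_le_of_le _ fun i _ => ?_
    rw [norm_smul, Real.norm_of_nonneg (h1 i).le, mul_comm]
    exact mul_le_mul_of_nonneg_right (h2 i) (h1 i).le
  · intro ε hε
    -- Chosen so that `δ / (c / 4) * M ≤ ε / 2`; the other half of `ε` pays for the variation of the
    -- normalized subgradients.
    set δ := min (c / 4) (ε * c / (8 * M))
    have hδ : 0 < δ := by positivity
    have hcauchy : ∀ᶠ s in atTop, ∀ t ≥ s, ∀ i,
        ‖(‖A (θ s)‖ ^ (L - 1))⁻¹ • H i s - (‖A (θ t)‖ ^ (L - 1))⁻¹ • H i t‖ ≤ ε / 2 := by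
      have h1 : ∀ᶠ t in atTop, ∀ i, ‖(‖A (θ t)‖ ^ (L - 1))⁻¹ • H i t - l i‖ < ε / 4 :=
        eventually_all.2 fun i => by
          simpa [dist_eq_norm] using
            Metric.tendsto_nhds.1 (h.tendsto_subgrad i) (ε / 4) (by positivity)
      filter_upwards [eventually_forall_ge_atTop.2 h1] with s hs t hst i
      rw [← sub_sub_sub_cancel_right _ _ (l i)]
      linarith [norm_sub_le ((‖A (θ s)‖ ^ (L - 1))⁻¹ • H i s - l i)
        ((‖A (θ t)‖ ^ (L - 1))⁻¹ • H i t - l i), hs s le_rfl i, hs t hst i]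
    filter_upwards [hpair δ hδ (min_le_left _ _), hcauchy, hlM, eventually_ge_atTop 0,
      eventually_forall_ge_atTop.2 hcoef', eventually_forall_ge_atTop.2 h.eventually_norm_pos]
      with s h1 h2 h3 h4 h5 h6 t hst
    rw [h.grad_eq_normalized h4 (h6 s le_rfl), h.grad_eq_normalized (h4.trans hst) (h6 t hst),
      neg_sub_neg, ← Finset.sum_sub_distrib, gradScale, Finset.mul_sum]
    refine norm_sum_le_of_le _ fun i _ => ?_
    have hexp : 1 ≤ Real.exp (c / 2 * (t - s)) :=
      Real.one_le_exp (mul_nonneg (by positivity) (sub_nonneg.2 hst))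
    have e1 := (h1 t hst i).2
    have e2 := h2 t hst i
    have e3 := h3 i
    have e5 := h5 t hst i
    generalize lossWeight φ (z i s) * ‖A (θ s)‖ ^ (L - 1) = bs at *
    generalize lossWeight φ (z i t) * ‖A (θ t)‖ ^ (L - 1) = bt at *
    generalize (‖A (θ s)‖ ^ (L - 1))⁻¹ • H i s = ls at *
    generalize (‖A (θ t)‖ ^ (L - 1))⁻¹ • H i t = lt at *
    have e6 : bt • lt - bs • ls = -((bs - bt) • ls + bt • (ls - lt)) := by module
    rw [e6, norm_neg]
    have hδM : δ / (c / 4) * M ≤ ε / 2 := by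
      have : δ ≤ ε * c / (8 * M) := min_le_right _ _
      calc δ / (c / 4) * M ≤ (ε * c / (8 * M)) / (c / 4) * M := by gcongr
        _ = ε / 2 := by field_simp; norm_num
    calc ‖(bs - bt) • ls + bt • (ls - lt)‖ ≤ |bs - bt| * ‖ls‖ + bt * ‖ls - lt‖ := by
          refine (norm_add_le _ _).trans ?_
          rw [norm_smul, norm_smul, Real.norm_eq_abs, Real.norm_of_nonneg e5.le]
      _ ≤ (δ / (c / 4) * Real.exp (c / 2 * (t - s)) * bt) * M + bt * (ε / 2) := by gcongr
      _ = δ / (c / 4) * M * Real.exp (c / 2 * (t - s)) * bt + ε / 2 * 1 * bt := by ring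
      _ ≤ ε / 2 * Real.exp (c / 2 * (t - s)) * bt + ε / 2 * Real.exp (c / 2 * (t - s)) * bt := by
          gcongr
      _ = _ := by ring
  · filter_upwards [hpair (c / 4) (by positivity) le_rfl] with s hs t hst
    rw [gradScale, gradScale, Finset.mul_sum]
    exact Finset.sum_le_sum fun i _ => (hs t hst i).1

end IsMarginFlow
end MarginFlow

theorem AbsolutelyContinuousOnInterval.sum {κ : Type*} {f : κ → ℝ → ℝ} {a b : ℝ} (s : Finset κ)
    (hf : ∀ i ∈ s, AbsolutelyContinuousOnInterval (f i) a b) :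
    AbsolutelyContinuousOnInterval (∑ i ∈ s, f i) a b := by
  classical
  induction s using Finset.induction_on with
  | empty =>
    have : LipschitzOnWith 0 (0 : ℝ → ℝ) (Set.uIcc a b) := fun x _ y _ => by simp
    simpa using this.absolutelyContinuousOnInterval
  | insert i s hi ih =>
    rw [Finset.sum_insert hi]
    exact (hf i (Finset.mem_insert_self _ _)).add
      (ih fun j hj => hf j (Finset.mem_insert_of_mem hj))

/-! ### Decay of the loss against growth of the norm, and alignment of the limit direction -/

section MarginFlow

variable {E : Type*} [NormedAddCommGroup E] [InnerProductSpace ℝ E]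
  {F : Type*} [NormedAddCommGroup F] [NormedSpace ℝ F] {ι : Type*} [Fintype ι]

/-- The loss as a function of the margins. -/
noncomputable def marginLoss (φ : ℝ → ℝ) (z : ι → ℝ → ℝ) (t : ℝ) : ℝ := ∑ i, Real.exp (-φ (z i t))

theorem marginLoss_pos [Nonempty ι] (φ : ℝ → ℝ) (z : ι → ℝ → ℝ) (t : ℝ) : 0 < marginLoss φ z t :=
  Finset.sum_pos (fun _ _ => Real.exp_pos _) Finset.univ_nonempty

theorem le_log_marginLoss (φ : ℝ → ℝ) (z : ι → ℝ → ℝ) (i : ι) (t : ℝ) :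
    -φ (z i t) ≤ Real.log (marginLoss φ z t) := by
  have h : Real.exp (-φ (z i t)) ≤ marginLoss φ z t :=
    Finset.single_le_sum (f := fun i => Real.exp (-φ (z i t))) (fun _ _ => (Real.exp_pos _).le)
      (Finset.mem_univ i)
  rw [Real.le_log_iff_exp_le ((Real.exp_pos _).trans_le h)]
  exact h

namespace IsMarginFlow

variable {A : E →L[ℝ] F} {φ : ℝ → ℝ} {c L : ℝ} {η : ℝ → ℝ} {θ g m : ℝ → E}
  {θbar : E} {z : ι → ℝ → ℝ} {H : ι → ℝ → E} {l : ι → E} {γ : ι → ℝ}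

theorem log_loss_ac [Nonempty ι] (h : IsMarginFlow A φ c L η θ g m θbar z H l γ) {s t : ℝ}
    (hs : 0 ≤ s) (ht : 0 ≤ t) :
    AbsolutelyContinuousOnInterval (fun x => Real.log (marginLoss φ z x)) s t := by
  have hG : LocallyLipschitz fun u => Real.exp (-φ u) :=
    (Real.contDiff_exp.comp (h.tailed.contDiff.of_le one_le_two).neg).locallyLipschitz
  have h1 : AbsolutelyContinuousOnInterval (marginLoss φ z) s t := by
    convert AbsolutelyContinuousOnInterval.sum Finset.univ
      (fun i _ => (h.margin_ac i s t hs ht).comp_locallyLipschitz hG) using 1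
    ext x
    simp [marginLoss]
  exact h1.comp_contDiffOn_Ioi (p := 0) (G := Real.log)
    (Real.contDiffOn_log.mono fun x hx => ne_of_gt hx) fun x _ => marginLoss_pos φ z x

theorem ae_differentiableAt_margin (h : IsMarginFlow A φ c L η θ g m θbar z H l γ) :
    ∀ᵐ t, 0 ≤ t → ∀ i, DifferentiableAt ℝ (z i) t := by
  have h1 : ∀ᵐ t : ℝ, ∀ (i : ι) (k : ℕ), t ∈ Set.uIcc 0 (k : ℝ) → DifferentiableAt ℝ (z i) t :=
    ae_all_iff.2 fun i => ae_all_iff.2 fun k =>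
      (h.margin_ac i 0 k le_rfl k.cast_nonneg).ae_differentiableAt
  filter_upwards [h1] with t ht ht0 i
  obtain ⟨k, hk⟩ := exists_nat_ge t
  exact ht i k (by rw [Set.uIcc_of_le k.cast_nonneg]; exact ⟨ht0, hk⟩)

/-- A lower bound on the dual norm of the gradient yields a decay rate of the loss. -/
theorem log_loss_deriv_le [CompleteSpace E] [Nonempty ι]
    (h : IsMarginFlow A φ c L η θ g m θbar z H l γ) {r r' : ℝ} (hr : r' < r)
    (hv : ∀ᶠ t in atTop, ∃ v, ‖A v‖ ≤ 1 ∧ r * gradScale A φ L θ z t ≤ inner ℝ v (g t)) :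
    ∀ᶠ T in atTop, ∀ᵐ t, T ≤ t → ∀ s, HasDerivAt (fun x => Real.log (marginLoss φ z x)) s t →
      s ≤ -(r' * η t * (gradScale A φ L θ z t / marginLoss φ z t)) := by
  obtain ⟨C, hC0, hC⟩ := h.bound
  -- `u` is optimal for `m`, not for `g`. Passing from `g` to `m` and back costs `2 * C * ‖m - g‖`,
  -- which the slack `r - r'` absorbs.
  have h1 := h.tendsto_momentum_sub_grad.eventually
    (gt_mem_nhds (show 0 < (r - r') / (2 * C + 1) from div_pos (by linarith) (by linarith)))
  have h2 := (hv.and h1).and ((eventually_ge_atTop 0).and h.eventually_norm_pos)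
  filter_upwards [eventually_forall_ge_atTop.2 h2] with T hT
  filter_upwards [h.step, h.chain, h.ae_differentiableAt_margin] with t hstep hchain hdiff hTt s hs
  obtain ⟨⟨⟨v, hv1, hv2⟩, hmg⟩, ht0, hN⟩ := hT t hTt
  obtain ⟨u, hu1, hu2, hu3⟩ := hstep ht0
  have hS := marginLoss_pos φ z t
  have hη := h.rate_pos t ht0
  have hB : 0 < gradScale A φ L θ z t :=
    Finset.sum_pos (fun i _ => mul_pos (h.tailed.lossWeight_pos _) (Real.rpow_pos_of_pos hN _))
      Finset.univ_nonempty
  have hz := fun i => (hdiff ht0 i).hasDerivAt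
  have hSd : HasDerivAt (marginLoss φ z) (inner ℝ (g t) (-(η t • u))) t := by
    have h3 : HasDerivAt (fun x => ∑ i, Real.exp (-φ (z i x)))
        (∑ i, Real.exp (-φ (z i t)) * -(deriv φ (z i t) * deriv (z i) t)) t :=
      HasDerivAt.fun_sum fun i _ =>
        (((h.tailed.differentiable _).hasDerivAt.comp t (hz i)).neg).exp
    refine h3.congr_deriv ?_
    rw [h.grad_eq t ht0, inner_neg_left, sum_inner, ← Finset.sum_neg_distrib]
    refine Finset.sum_congr rfl fun i _ => ?_
    rw [inner_smul_left, hchain ht0 i _ _ hu3 (hz i)]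
    simp
    ring
  -- The same derivative computed from that of the logarithm; uniqueness identifies `s`.
  have hSs : HasDerivAt (marginLoss φ z) (marginLoss φ z t * s) t := by
    have h4 := hs.exp
    simp only [fun x => Real.exp_log (marginLoss_pos φ z x)] at h4
    exact h4
  have heq := hSs.unique hSd
  rw [inner_neg_right, inner_smul_right, real_inner_comm] at heq
  have hCb : ∀ v, ‖A v‖ ≤ 1 → |inner ℝ v (m t - g t)| ≤ C * ‖m t - g t‖ := fun v hv => by
    refine (abs_real_inner_le_norm _ _).trans ?_
    gcongr
    exact (hC v).trans (mul_le_of_le_one_right hC0 hv)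
  have e1 := abs_le.1 (hCb u hu1)
  have e2 := abs_le.1 (hCb v hv1)
  have e3 := hu2 v hv1
  rw [inner_sub_right] at e1 e2
  rw [div_lt_iff₀ hB] at hmg
  have e4 : 2 * (C * ‖m t - g t‖) ≤ (r - r') * gradScale A φ L θ z t := by
    have : (2 * C + 1) * ‖m t - g t‖ ≤ (r - r') * gradScale A φ L θ z t := by
      calc _ ≤ (2 * C + 1) * ((r - r') / (2 * C + 1) * gradScale A φ L θ z t) := by gcongr
        _ = _ := by field_simp
    linarith [norm_nonneg (m t - g t)]
  have e5 : r' * gradScale A φ L θ z t ≤ inner ℝ u (g t) := by linarith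
  rw [← mul_div_assoc, ← neg_div, le_div_iff₀ hS]
  calc s * marginLoss φ z t = -(η t * inner ℝ u (g t)) := by rw [mul_comm, heq]
    _ ≤ -(η t * (r' * gradScale A φ L θ z t)) := by gcongr
    _ = _ := by ring

/-- Turns a decay rate in terms of `gradScale / marginLoss` into one in terms of `‖A θ‖ ^ (L - 1)`.
-/
theorem mul_marginLoss_le_gradScale {q t : ℝ}
    (hq : ∀ i, q ≤ deriv φ (z i t)) :
    q * ‖A (θ t)‖ ^ (L - 1) * marginLoss φ z t ≤ gradScale A φ L θ z t := by
  rw [marginLoss, Finset.mul_sum, gradScale]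
  refine Finset.sum_le_sum fun i _ => ?_
  calc q * ‖A (θ t)‖ ^ (L - 1) * Real.exp (-φ (z i t)) =
        Real.exp (-φ (z i t)) * q * ‖A (θ t)‖ ^ (L - 1) := by ring
    _ ≤ _ := by
      rw [lossWeight]
      gcongr
      exact hq i

theorem tendsto_integral_rate (h : IsMarginFlow A φ c L η θ g m θbar z H l γ) {T : ℝ}
    (hT : 0 ≤ T) : Tendsto (fun t => ∫ x in T..t, η x) atTop atTop := by
  have := tendsto_atTop_add_const_right atTop (-∫ x in (0 : ℝ)..T, η x) h.schedule.integral_eq_top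
  refine this.congr' ?_
  filter_upwards [eventually_ge_atTop T] with t ht
  rw [← sub_eq_add_neg, intervalIntegral.integral_interval_sub_left
    (h.schedule.integrable t (hT.trans ht)) (h.schedule.integrable T hT)]

/-- Integrated form of a decay rate of the loss. -/
theorem log_loss_sub_le [Nonempty ι] (h : IsMarginFlow A φ c L η θ g m θbar z H l γ)
    {r q T : ℝ} (hr : 0 ≤ r) (hT : 0 ≤ T) (hq : ∀ t ≥ T, ∀ i, q ≤ deriv φ (z i t))
    (hd : ∀ᵐ t, T ≤ t → ∀ s, HasDerivAt (fun x => Real.log (marginLoss φ z x)) s t →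
      s ≤ -(r * η t * (gradScale A φ L θ z t / marginLoss φ z t))) {t : ℝ} (ht : T ≤ t) :
    Real.log (marginLoss φ z t) - Real.log (marginLoss φ z T) ≤
      -(r * q * ∫ x in T..t, η x * ‖A (θ x)‖ ^ (L - 1)) := by
  have hcont : ContinuousOn (fun x => ‖A (θ x)‖ ^ (L - 1)) (Set.uIcc T t) :=
    (h.norm_ac hT (hT.trans ht)).continuousOn.rpow_const
      fun _ _ => Or.inr (sub_nonneg.2 h.one_le)
  have hint : IntervalIntegrable (fun x => η x * ‖A (θ x)‖ ^ (L - 1)) volume T t :=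
    (h.rate_integrable hT (hT.trans ht)).mul_continuousOn hcont
  have := (h.log_loss_ac hT (hT.trans ht)).sub_le_integral ht (hint.const_mul (-(r * q))) ?_
  · rwa [intervalIntegral.integral_const_mul, neg_mul] at this
  · filter_upwards [hd] with x hx hxI s hs
    refine (hx hxI.1 s hs).trans ?_
    have h1 := mul_marginLoss_le_gradScale (A := A) (L := L) (θ := θ) (hq x hxI.1)
    rw [← le_div_iff₀ (marginLoss_pos φ z x)] at h1
    have hη := h.rate_pos x (hT.trans hxI.1)
    rw [neg_mul, neg_le_neg_iff]
    calc _ = r * η x * (q * ‖A (θ x)‖ ^ (L - 1)) := by ring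
      _ ≤ _ := by gcongr

/-- The gradient of the loss has a definite component along the limit direction. -/
theorem eventually_le_inner_neg_dir [Nonempty ι]
    (h : IsMarginFlow A φ c L η θ g m θbar z H l γ) :
    ∃ r, 0 < r ∧ ∀ᶠ t in atTop, r * gradScale A φ L θ z t ≤ inner ℝ (-θbar) (g t) := by
  obtain ⟨j, hj⟩ := Finite.exists_min γ
  have hL : 0 < L := zero_lt_one.trans_le h.one_le
  have hγ := h.margin_pos j
  -- By Euler's identity the pairings tend to `L * γ i ≥ L * γ j`; the factor `1 / 2` leaves room
  -- for convergence.
  refine ⟨L * γ j / 2, by positivity, ?_⟩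
  have h1 : ∀ᶠ t in atTop, ∀ i, L * γ j / 2 <
      inner ℝ ((‖A (θ t)‖ ^ (L - 1))⁻¹ • H i t) θbar := by
    refine eventually_all.2 fun i => ((h.tendsto_subgrad i).inner tendsto_const_nhds).eventually
      (lt_mem_nhds ?_)
    rw [h.euler i]
    have : L * γ j ≤ L * γ i := by gcongr; exact hj i
    have : 0 < L * γ j := by positivity
    linarith
  filter_upwards [h1, eventually_ge_atTop 0, h.eventually_norm_pos] with t ht ht0 hN
  rw [h.grad_eq_normalized ht0 hN, inner_neg_neg, real_inner_comm, sum_inner, gradScale,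
    Finset.mul_sum]
  refine Finset.sum_le_sum fun i _ => ?_
  rw [inner_smul_left, mul_comm]
  have := h.tailed.lossWeight_pos (z i t)
  exact mul_le_mul_of_nonneg_left (ht i).le (by positivity)

theorem eventually_gradScale_pos [Nonempty ι] (h : IsMarginFlow A φ c L η θ g m θbar z H l γ) :
    ∀ᶠ t in atTop, 0 < gradScale A φ L θ z t :=
  h.eventually_norm_pos.mono fun _ ht => Finset.sum_pos
    (fun _ _ => mul_pos (h.tailed.lossWeight_pos _) (Real.rpow_pos_of_pos ht _))
      Finset.univ_nonempty

/-- The norm of `g` is at least a fixed multiple of `gradScale`, whereas `m - g` is negligible on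
that scale. -/
theorem eventually_momentum_ne_zero [CompleteSpace E] [Nonempty ι]
    (h : IsMarginFlow A φ c L η θ g m θbar z H l γ) : ∀ᶠ t in atTop, m t ≠ 0 := by
  obtain ⟨r, hr, hev⟩ := h.eventually_le_inner_neg_dir
  filter_upwards [hev, h.eventually_gradScale_pos, h.tendsto_momentum_sub_grad.eventually
    (gt_mem_nhds (show 0 < r / (‖θbar‖ + 1) by positivity))] with t h1 h2 h3 h4
  rw [h4, zero_sub, norm_neg, div_lt_div_iff₀ h2 (by positivity)] at h3
  have h5 := real_inner_le_norm (-θbar) (g t)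
  rw [norm_neg] at h5
  linarith [norm_nonneg (g t), mul_comm ‖θbar‖ ‖g t‖]

/-- Testing with `-θbar` makes `log` of the loss decrease at least at a constant times `η`, because
eventually `φ' ≥ φ' 0` and the norm is at least `p`; the integral of `η` diverges. -/
theorem tendsto_log_loss [CompleteSpace E] [Nonempty ι]
    (h : IsMarginFlow A φ c L η θ g m θbar z H l γ) :
    Tendsto (fun t => Real.log (marginLoss φ z t)) atTop atBot := by
  obtain ⟨r, hr, hev⟩ := h.eventually_le_inner_neg_dir
  obtain ⟨p, hp, hpN⟩ := h.nontrivial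
  have h1 := h.log_loss_deriv_le (half_lt_self hr)
    (hev.mono fun t ht => ⟨-θbar, by rw [map_neg, norm_neg, h.norm_dir], ht⟩)
  have h2 := eventually_forall_ge_atTop.2
    ((eventually_all.2 h.eventually_margin_pos).and hpN)
  obtain ⟨T, hT1, hT2, hT0⟩ := (h1.and (h2.and (eventually_ge_atTop 0))).exists
  have hd0 := h.tailed.deriv_pos 0
  have hκ : 0 < r / 2 * deriv φ 0 * p ^ (L - 1) := by positivity
  have hlim : Tendsto (fun t => Real.log (marginLoss φ z T) +
      -(r / 2 * deriv φ 0 * p ^ (L - 1) * ∫ x in T..t, η x)) atTop atBot :=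
    tendsto_atBot_add_const_left _ _
      (tendsto_neg_atTop_atBot.comp ((h.tendsto_integral_rate hT0).const_mul_atTop hκ))
  refine tendsto_atBot_mono' _ ?_ hlim
  filter_upwards [eventually_ge_atTop T] with t ht
  have h3 := h.log_loss_sub_le (half_pos hr).le hT0
    (fun x hx i => h.tailed.monotone_deriv ((hT2 x hx).1 i).le) hT1 ht
  have h4 : p ^ (L - 1) * ∫ x in T..t, η x ≤ ∫ x in T..t, η x * ‖A (θ x)‖ ^ (L - 1) := by
    have hcont : ContinuousOn (fun x => ‖A (θ x)‖ ^ (L - 1)) (Set.uIcc T t) :=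
      (h.norm_ac hT0 (hT0.trans ht)).continuousOn.rpow_const
        fun _ _ => Or.inr (sub_nonneg.2 h.one_le)
    rw [← intervalIntegral.integral_const_mul]
    refine intervalIntegral.integral_mono_on ht
      ((h.rate_integrable hT0 (hT0.trans ht)).const_mul _)
      ((h.rate_integrable hT0 (hT0.trans ht)).mul_continuousOn hcont) fun x hx => ?_
    have := h.rate_pos x (hT0.trans hx.1)
    have := h.one_le
    rw [mul_comm]
    gcongr
    exact (hT2 x hx.1).2
  have h5 : r / 2 * deriv φ 0 * (p ^ (L - 1) * ∫ x in T..t, η x) ≤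
      r / 2 * deriv φ 0 * ∫ x in T..t, η x * ‖A (θ x)‖ ^ (L - 1) := by gcongr
  linarith

theorem tendsto_margin_atTop [CompleteSpace E] [Nonempty ι]
    (h : IsMarginFlow A φ c L η θ g m θbar z H l γ) (i : ι) : Tendsto (z i) atTop atTop := by
  have h1 : Tendsto (fun t => φ (z i t)) atTop atTop :=
    tendsto_atTop_mono (fun t => neg_le.1 (le_log_marginLoss φ z i t))
      (tendsto_neg_atBot_atTop.comp h.tendsto_log_loss)
  refine tendsto_atTop.2 fun b => ?_
  filter_upwards [h1.eventually_ge_atTop (φ b)] with t ht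
  exact h.tailed.strictMono.le_iff_le.1 ht

/-- Margins diverge and are eventually at most `2 * γ i * ‖A θ‖ ^ L`. -/
theorem tendsto_norm_rpow_atTop [CompleteSpace E] [Nonempty ι]
    (h : IsMarginFlow A φ c L η θ g m θbar z H l γ) :
    Tendsto (fun t => ‖A (θ t)‖ ^ L) atTop atTop := by
  obtain ⟨i⟩ := ‹Nonempty ι›
  have hγ := h.margin_pos i
  have h1 : Tendsto (fun t => (2 * γ i)⁻¹ * z i t) atTop atTop :=
    (have : Nonempty ι := ⟨i⟩; h.tendsto_margin_atTop i).const_mul_atTop (by positivity)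
  refine tendsto_atTop_mono' _ ?_ h1
  filter_upwards [(h.tendsto_margin i).eventually (gt_mem_nhds
    (show γ i < 2 * γ i by linarith)), h.eventually_norm_pos] with t ht hN
  rw [div_lt_iff₀ (Real.rpow_pos_of_pos hN L)] at ht
  rw [inv_mul_le_iff₀ (by positivity)]
  exact ht.le

/-- The loss cannot decay faster than allowed by the growth of the norm. -/
theorem rate_le [CompleteSpace E] [Nonempty ι] (h : IsMarginFlow A φ c L η θ g m θbar z H l γ)
    (j : ι) {r : ℝ} (hd : ∀ᶠ T in atTop, ∀ᵐ t, T ≤ t → ∀ s,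
      HasDerivAt (fun x => Real.log (marginLoss φ z x)) s t →
        s ≤ -(r * η t * (gradScale A φ L θ z t / marginLoss φ z t))) : r ≤ L * γ j := by
  by_contra! hr
  obtain ⟨p, hp, hpt, hple⟩ := h.tailed.exists_tendsto_deriv
  obtain ⟨b, hb, hbN⟩ := h.nontrivial
  have hL : 0 < L := zero_lt_one.trans_le h.one_le
  have hγ := h.margin_pos j
  have hLγ : 0 < L * γ j := by positivity
  -- Room is made on both sides: `r₁ > L * γ j` lets `z j ≤ r₁ / L * ‖A θ‖ ^ L` hold eventually, and
  -- `q < p` lets `φ' ≥ q` hold eventually, with `r * q` still above `p * r₁`.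
  set r₁ := (L * γ j + r) / 2 with hr₁
  have hr0 : 0 < r := hLγ.trans hr
  have hr₁r : r₁ < r := by linarith
  set q := p * ((r₁ + r) / (2 * r)) with hq
  have hqp : q < p := by
    rw [hq]
    refine mul_lt_of_lt_one_right hp ?_
    rw [div_lt_one (by positivity)]
    linarith
  have hrq : r * q - p * r₁ = p * (r - r₁) / 2 := by
    rw [hq]
    field_simp
    ring
  have hgap : 0 < r * q - p * r₁ := by
    rw [hrq]
    have := sub_pos.2 hr₁r
    positivity
  have hγr₁ : γ j < r₁ / L := by
    rw [lt_div_iff₀ hL]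
    linarith
  have h1 := eventually_forall_ge_atTop.2 ((eventually_all.2 fun i =>
    (hpt.comp (h.tendsto_margin_atTop i)).eventually (lt_mem_nhds hqp)).and
    (hbN.and (((h.tendsto_margin j).eventually (gt_mem_nhds hγr₁)).and
      (h.eventually_margin_pos j))))
  obtain ⟨T, hT1, hT2, hT0⟩ := (hd.and (h1.and (eventually_ge_atTop 0))).exists
  have hNpos : ∀ t ≥ T, 0 < ‖A (θ t)‖ := fun t ht => hb.trans_le (hT2 t ht).2.1
  have hcont : ∀ t ≥ T, ContinuousOn (fun x => ‖A (θ x)‖ ^ (L - 1)) (Set.uIcc T t) := fun t ht =>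
    (h.norm_ac hT0 (hT0.trans ht)).continuousOn.rpow_const
      fun _ _ => Or.inr (sub_nonneg.2 h.one_le)
  have hint : ∀ t ≥ T, IntervalIntegrable (fun x => η x * ‖A (θ x)‖ ^ (L - 1)) volume T t :=
    fun t ht => (h.rate_integrable hT0 (hT0.trans ht)).mul_continuousOn (hcont t ht)
  set J : ℝ → ℝ := fun t => ∫ x in T..t, η x * ‖A (θ x)‖ ^ (L - 1)
  have hNL : ∀ t ≥ T, ‖A (θ t)‖ ^ L ≤ ‖A (θ T)‖ ^ L + L * J t := by
    intro t ht
    have hac : AbsolutelyContinuousOnInterval ((fun y : ℝ => y ^ L) ∘ fun x => ‖A (θ x)‖) T t := by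
      refine (h.norm_ac hT0 (hT0.trans ht)).comp_contDiffOn_Ioi (p := 0) ?_ fun x hx => ?_
      · exact fun y hy => (Real.contDiffAt_rpow_const_of_ne (ne_of_gt hy)).contDiffWithinAt
      · rw [Set.uIcc_of_le ht] at hx
        exact hNpos x hx.1
    have := hac.sub_le_integral ht ((hint t ht).const_mul L) ?_
    · rw [intervalIntegral.integral_const_mul] at this
      simp only [Function.comp_apply] at this
      linarith
    · filter_upwards [h.ae_abs_deriv_norm_le] with x hx hxI s hs
      have hx0 := hT0.trans hxI.1
      have hNx := hNpos x hxI.1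
      -- `s` is a derivative of the `L`-th power; taking the `L`-th root recovers one of the norm
      -- itself, bounded by `η`.
      have hN' : HasDerivAt (fun y => (‖A (θ y)‖ ^ L) ^ L⁻¹)
          (s * L⁻¹ * (‖A (θ x)‖ ^ L) ^ (L⁻¹ - 1)) x :=
        HasDerivAt.rpow_const hs (Or.inl (Real.rpow_pos_of_pos hNx L).ne')
      have e1 : (fun y => (‖A (θ y)‖ ^ L) ^ L⁻¹) = fun y => ‖A (θ y)‖ := by
        funext y
        rw [← Real.rpow_mul (norm_nonneg _), mul_inv_cancel₀ hL.ne', Real.rpow_one]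
      rw [e1, ← Real.rpow_mul hNx.le, mul_sub, mul_inv_cancel₀ hL.ne', mul_one] at hN'
      have e2 := (le_abs_self _).trans (hx hx0 _ hN')
      have e3 : ‖A (θ x)‖ ^ (1 - L) * ‖A (θ x)‖ ^ (L - 1) = 1 := by
        rw [← Real.rpow_add hNx]
        simp
      calc s = L * (s * L⁻¹ * ‖A (θ x)‖ ^ (1 - L)) * ‖A (θ x)‖ ^ (L - 1) := by
            rw [mul_assoc L, mul_assoc (s * L⁻¹), e3]
            field_simp
        _ ≤ L * η x * ‖A (θ x)‖ ^ (L - 1) := by gcongr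
        _ = _ := by ring
  have hJ : Tendsto J atTop atTop := by
    refine tendsto_atTop_mono' _ ?_ (tendsto_atTop_add_const_right _ (-(L⁻¹ * ‖A (θ T)‖ ^ L))
      (h.tendsto_norm_rpow_atTop.const_mul_atTop (inv_pos.2 hL)))
    filter_upwards [eventually_ge_atTop T] with t ht
    have := mul_le_mul_of_nonneg_left (hNL t ht) (inv_pos.2 hL).le
    rw [mul_add, inv_mul_cancel_left₀ hL.ne'] at this
    linarith
  -- The upper bound on `log` of the loss has slope `-(r * q)` in `J`, the lower bound from `z j`
  -- has slope `-(p * r₁)`. They cross once `(r * q - p * r₁) * J` exceeds `D`.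
  set D := Real.log (marginLoss φ z T) + φ 0 + p * (r₁ / L) * ‖A (θ T)‖ ^ L
  obtain ⟨t, htJ, ht⟩ := ((hJ.const_mul_atTop hgap).eventually_gt_atTop D |>.and
    (eventually_ge_atTop T)).exists
  obtain ⟨-, -, hzt, hzt0⟩ := hT2 t ht
  rw [div_lt_iff₀ (Real.rpow_pos_of_pos (hNpos t ht) L)] at hzt
  have e1 := h.log_loss_sub_le hr0.le hT0 (fun x hx i => ((hT2 x hx).1 i).le) hT1 ht
  have e2 := le_log_marginLoss φ z j t
  have e3 := h.tailed.le_add_mul hple hzt0.le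
  have e4 : p * z j t ≤ p * (r₁ / L * (‖A (θ T)‖ ^ L + L * J t)) := by
    have hr₁L : 0 ≤ r₁ / L := by positivity
    gcongr
    exact hzt.le.trans (mul_le_mul_of_nonneg_left (hNL t ht) hr₁L)
  have e5 : p * (r₁ / L * (‖A (θ T)‖ ^ L + L * J t)) =
      p * (r₁ / L) * ‖A (θ T)‖ ^ L + p * r₁ * J t := by
    field_simp
  have e6 : (r * q - p * r₁) * J t = r * q * J t - p * r₁ * J t := by ring
  simp only [D] at htJ
  linarith

/-- The weights of margins which are not asymptotically minimal become negligible. -/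
theorem tendsto_weight_div [CompleteSpace E] [Nonempty ι]
    (h : IsMarginFlow A φ c L η θ g m θbar z H l γ) {i j : ι} (hij : γ j < γ i) :
    Tendsto (fun t => lossWeight φ (z i t) / lossWeight φ (z j t)) atTop (𝓝 0) := by
  obtain ⟨p, hp, -, hple⟩ := h.tailed.exists_tendsto_deriv
  have hd0 := h.tailed.deriv_pos 0
  -- The gap grows like `(γ i - γ j) * ‖A θ‖ ^ L`, and `φ' ≥ φ' 0` converts it into an exponentially
  -- small ratio.
  have hgap : Tendsto (fun t => z i t - z j t) atTop atTop := by
    have h1 := ((h.tendsto_margin i).sub (h.tendsto_margin j)).pos_mul_atTop (sub_pos.2 hij)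
      h.tendsto_norm_rpow_atTop
    refine h1.congr' ?_
    filter_upwards [h.eventually_norm_pos] with t ht
    have := (Real.rpow_pos_of_pos ht L).ne'
    field_simp
  have hlim : Tendsto (fun t => p / deriv φ 0 * Real.exp (-(deriv φ 0 * (z i t - z j t))))
      atTop (𝓝 0) := by
    simpa using (Real.tendsto_exp_atBot.comp (tendsto_neg_atTop_atBot.comp
      (hgap.const_mul_atTop hd0))).const_mul (p / deriv φ 0)
  refine squeeze_zero' (Eventually.of_forall fun t => (div_pos (h.tailed.lossWeight_pos _)
    (h.tailed.lossWeight_pos _)).le) ?_ hlim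
  filter_upwards [hgap.eventually_ge_atTop 0, h.eventually_margin_pos j] with t ht hzj
  have hwj := h.tailed.deriv_pos (z j t)
  have e1 : deriv φ 0 * (z i t - z j t) ≤ φ (z i t) - φ (z j t) :=
    (convex_Ici (0 : ℝ)).mul_sub_le_image_sub_of_le_deriv
      h.tailed.differentiable.continuous.continuousOn h.tailed.differentiable.differentiableOn
      (fun x hx => h.tailed.monotone_deriv (interior_subset hx)) _ hzj.le _
      (hzj.le.trans (sub_nonneg.1 ht)) (sub_nonneg.1 ht)
  rw [lossWeight, lossWeight, mul_div_mul_comm, ← Real.exp_sub, mul_comm]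
  gcongr
  · exact hple _
  · exact h.tailed.monotone_deriv hzj.le
  · linarith

/-- The limit direction is aligned with a convex combination of the limiting subgradients of the
minimal margins. -/
theorem exists_aligned [CompleteSpace E] [Nonempty ι]
    (h : IsMarginFlow A φ c L η θ g m θbar z H l γ) (j : ι) :
    ∃ π ∈ stdSimplex ℝ ι, (∀ i, γ j < γ i → π i = 0) ∧
      ∀ v, ‖A v‖ ≤ 1 → inner ℝ v (∑ i, π i • l i) ≤ L * γ j := by
  -- Otherwise the dual norm of `g` would eventually exceed the threshold, and half of the excess `1
  -- / (k + 1)` would already contradict `rate_le`.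
  have hfreq : ∀ k : ℕ, ∃ᶠ t in atTop, ∀ v, ‖A v‖ ≤ 1 →
      inner ℝ v (g t) ≤ (L * γ j + 1 / ((k : ℝ) + 1)) * gradScale A φ L θ z t := by
    intro k
    by_contra hcon
    rw [not_frequently] at hcon
    push Not at hcon
    have hk : (0 : ℝ) < 1 / ((k : ℝ) + 1) := by positivity
    have := h.rate_le j (h.log_loss_deriv_le
      (show L * γ j + 1 / ((k : ℝ) + 1) / 2 < L * γ j + 1 / ((k : ℝ) + 1) by linarith)
      (hcon.mono fun t ⟨v, hv1, hv2⟩ => ⟨v, hv1, hv2.le⟩))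
    linarith
  have hex : ∀ k : ℕ, ∃ t : ℝ, (∀ v, ‖A v‖ ≤ 1 →
      inner ℝ v (g t) ≤ (L * γ j + 1 / ((k : ℝ) + 1)) * gradScale A φ L θ z t) ∧ (k : ℝ) ≤ t :=
    fun k => ((hfreq k).and_eventually (eventually_ge_atTop _)).exists
  choose τ hτ hτk using hex
  have hτlim : Tendsto τ atTop atTop := tendsto_atTop_mono hτk tendsto_natCast_atTop_atTop
  let W : ℝ → ℝ := fun t => ∑ i, lossWeight φ (z i t)
  have hW : ∀ t, 0 < W t := fun t =>
    Finset.sum_pos (fun i _ => h.tailed.lossWeight_pos _) Finset.univ_nonempty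
  let P : ℝ → ι → ℝ := fun t i => lossWeight φ (z i t) / W t
  have hP : ∀ t, P t ∈ stdSimplex ℝ ι := fun t =>
    ⟨fun i => (div_pos (h.tailed.lossWeight_pos _) (hW t)).le, by
      simp only [P]
      rw [← Finset.sum_div, div_self (hW t).ne']⟩
  obtain ⟨π, hπ, ψ, hψ, hlim⟩ := (isCompact_stdSimplex ℝ ι).tendsto_subseq fun k => hP (τ k)
  have hτψ := hτlim.comp hψ.tendsto_atTop
  have hπi : ∀ i, Tendsto (fun k => P (τ (ψ k)) i) atTop (𝓝 (π i)) := fun i =>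
    (tendsto_pi_nhds.1 hlim) i
  refine ⟨π, hπ, fun i hi => ?_, fun v hv => ?_⟩
  · refine tendsto_nhds_unique (hπi i) (squeeze_zero (fun k => (hP _).1 i) (fun k => ?_)
      ((h.tendsto_weight_div hi).comp hτψ))
    exact div_le_div_of_nonneg_left (h.tailed.lossWeight_pos _).le (h.tailed.lossWeight_pos _)
      (Finset.single_le_sum (f := fun i => lossWeight φ (z i (τ (ψ k))))
        (fun i _ => (h.tailed.lossWeight_pos _).le) (Finset.mem_univ j))
  · have h1 : Tendsto (fun k => inner ℝ v (∑ i, P (τ (ψ k)) i •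
        ((‖A (θ (τ (ψ k)))‖ ^ (L - 1))⁻¹ • H i (τ (ψ k))))) atTop
        (𝓝 (inner ℝ v (∑ i, π i • l i))) :=
      tendsto_const_nhds.inner (tendsto_finsetSum _ fun i _ =>
        (hπi i).smul ((h.tendsto_subgrad i).comp hτψ))
    have h2 : Tendsto (fun k => L * γ j + 1 / ((ψ k : ℝ) + 1)) atTop (𝓝 (L * γ j)) := by
      simpa using (tendsto_one_div_add_atTop_nhds_zero_nat.comp
        hψ.tendsto_atTop).const_add (L * γ j)
    refine le_of_tendsto_of_tendsto h1 h2 ?_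
    filter_upwards [hτψ.eventually (eventually_ge_atTop 0),
      hτψ.eventually h.eventually_norm_pos] with k hk0 hkN
    -- Tested at `-v` since `g` is minus the combination of subgradients; dividing by `gradScale`
    -- leaves convex weights `P`.
    have h3 := hτ (ψ k) (-v) (by rwa [map_neg, norm_neg])
    have hρ := Real.rpow_pos_of_pos hkN (L - 1)
    simp only [Function.comp_apply] at hk0 hkN
    rw [h.grad_eq_normalized hk0 hkN, inner_neg_neg] at h3
    have h4 : gradScale A φ L θ z (τ (ψ k)) = ‖A (θ (τ (ψ k)))‖ ^ (L - 1) * W (τ (ψ k)) := by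
      simp only [gradScale, W]
      rw [Finset.mul_sum]
      exact Finset.sum_congr rfl fun i _ => mul_comm _ _
    have h5 : ∑ i, (lossWeight φ (z i (τ (ψ k))) * ‖A (θ (τ (ψ k)))‖ ^ (L - 1)) •
          ((‖A (θ (τ (ψ k)))‖ ^ (L - 1))⁻¹ • H i (τ (ψ k))) =
        (‖A (θ (τ (ψ k)))‖ ^ (L - 1) * W (τ (ψ k))) • ∑ i, P (τ (ψ k)) i •
          ((‖A (θ (τ (ψ k)))‖ ^ (L - 1))⁻¹ • H i (τ (ψ k))) := by
      rw [Finset.smul_sum]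
      refine Finset.sum_congr rfl fun i _ => ?_
      rw [smul_smul (_ * W _)]
      congr 1
      simp only [P]
      have := (hW (τ (ψ k))).ne'
      field_simp
    rw [h4, h5, inner_smul_right, mul_comm (L * γ j + _)] at h3
    exact le_of_mul_le_mul_left h3 (mul_pos hρ (hW _))

end IsMarginFlow
end MarginFlow

/-! ### The spectral norm and reduced singular value decompositions -/

section Spectral

open scoped Matrix.Norms.L2Operator

theorem Matrix.abs_apply_le_l2_opNorm {p q : ℕ} (W : Matrix (Fin p) (Fin q) ℝ) (i : Fin p)
    (j : Fin q) : |W i j| ≤ ‖W‖ := by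
  have h1 := W.l2_opNorm_mulVec (EuclideanSpace.single j 1)
  have h2 := PiLp.norm_apply_le
    ((EuclideanSpace.equiv (Fin p) ℝ).symm (W.mulVec (EuclideanSpace.single j (1 : ℝ)).ofLp)) i
  simpa using h2.trans h1

theorem Matrix.l2_opNorm_le_one_of_transpose_mul_self {p r : ℕ} {U : Matrix (Fin p) (Fin r) ℝ}
    (hU : U.transpose * U = 1) : ‖U‖ ≤ 1 := by
  have h1 := U.l2_opNorm_conjTranspose_mul_self
  rw [Matrix.conjTranspose_eq_transpose_of_trivial, hU] at h1
  have h2 : ‖(1 : Matrix (Fin r) (Fin r) ℝ)‖ ≤ 1 := by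
    rcases r with _ | r
    · simp [Subsingleton.elim (1 : Matrix (Fin 0) (Fin 0) ℝ) 0]
    · exact norm_one.le
  nlinarith [norm_nonneg U]

theorem Matrix.l2_opNorm_transpose {p q : ℕ} (W : Matrix (Fin p) (Fin q) ℝ) :
    ‖W.transpose‖ = ‖W‖ := by
  rw [← Matrix.conjTranspose_eq_transpose_of_trivial, Matrix.l2_opNorm_conjTranspose]

namespace IsReducedSVD

variable {p q r : ℕ} {M : Matrix (Fin p) (Fin q) ℝ} {U : Matrix (Fin p) (Fin r) ℝ}
  {σ : Fin r → ℝ} {V : Matrix (Fin q) (Fin r) ℝ}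

theorem norm_polar_le (h : IsReducedSVD M U σ V) : ‖U * V.transpose‖ ≤ 1 := by
  refine (Matrix.l2_opNorm_mul _ _).trans ?_
  rw [Matrix.l2_opNorm_transpose]
  exact mul_le_one₀ (Matrix.l2_opNorm_le_one_of_transpose_mul_self h.left_orthonormal)
    (norm_nonneg _) (Matrix.l2_opNorm_le_one_of_transpose_mul_self h.right_orthonormal)

/-- `Uᵀ (U Vᵀ) V` is the identity while `Uᵀ` and `V` are contractions. `M ≠ 0` excludes rank 0,
where the polar factor is 0. -/
theorem norm_polar (h : IsReducedSVD M U σ V) (hM : M ≠ 0) : ‖U * V.transpose‖ = 1 := by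
  refine le_antisymm h.norm_polar_le ?_
  rcases r with _ | r
  · refine absurd ?_ hM
    rw [h.eq]
    ext i j
    simp [Matrix.mul_apply]
  have h1 : U.transpose * (U * V.transpose) * V = 1 := by
    rw [← Matrix.mul_assoc, h.left_orthonormal, Matrix.one_mul, h.right_orthonormal]
  have hU := Matrix.l2_opNorm_le_one_of_transpose_mul_self h.left_orthonormal
  have hV := Matrix.l2_opNorm_le_one_of_transpose_mul_self h.right_orthonormal
  rw [← Matrix.l2_opNorm_transpose] at hU
  calc (1 : ℝ) = ‖U.transpose * (U * V.transpose) * V‖ := by rw [h1, norm_one]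
    _ ≤ ‖U.transpose‖ * ‖U * V.transpose‖ * ‖V‖ :=
        (Matrix.l2_opNorm_mul _ _).trans (by gcongr; exact Matrix.l2_opNorm_mul _ _)
    _ ≤ 1 * ‖U * V.transpose‖ * 1 := by gcongr
    _ = _ := by ring

theorem trace_transpose_mul (h : IsReducedSVD M U σ V) (W : Matrix (Fin p) (Fin q) ℝ) :
    (W.transpose * M).trace = ∑ i, σ i * (U.transpose * W * V) i i := by
  have h1 : (W.transpose * M).trace =
      (Matrix.diagonal σ * (U.transpose * W * V).transpose).trace := by
    rw [h.eq, ← Matrix.mul_assoc, Matrix.trace_mul_comm, ← Matrix.mul_assoc, ← Matrix.mul_assoc,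
      Matrix.trace_mul_comm]
    simp only [Matrix.transpose_mul, Matrix.transpose_transpose, Matrix.mul_assoc]
  rw [h1, Matrix.trace]
  simp only [Matrix.diag_apply, Matrix.diagonal_mul, Matrix.transpose_apply]

/-- The polar factor maximizes the Frobenius inner product with `M` over the unit ball of the
spectral norm. -/
theorem trace_le (h : IsReducedSVD M U σ V) {W : Matrix (Fin p) (Fin q) ℝ} (hW : ‖W‖ ≤ 1) :
    (W.transpose * M).trace ≤ ((U * V.transpose).transpose * M).trace := by
  rw [h.trace_transpose_mul, h.trace_transpose_mul]
  refine Finset.sum_le_sum fun i _ => mul_le_mul_of_nonneg_left ?_ (h.pos i).le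
  have hU := Matrix.l2_opNorm_le_one_of_transpose_mul_self h.left_orthonormal
  have hV := Matrix.l2_opNorm_le_one_of_transpose_mul_self h.right_orthonormal
  rw [← Matrix.l2_opNorm_transpose] at hU
  rw [← Matrix.mul_assoc, h.left_orthonormal, Matrix.one_mul, h.right_orthonormal,
    Matrix.one_apply_eq]
  calc (U.transpose * W * V) i i ≤ ‖U.transpose * W * V‖ :=
        (le_abs_self _).trans (Matrix.abs_apply_le_l2_opNorm _ i i)
    _ ≤ ‖U.transpose‖ * ‖W‖ * ‖V‖ :=
        (Matrix.l2_opNorm_mul _ _).trans (by gcongr; exact Matrix.l2_opNorm_mul _ _)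
    _ ≤ 1 * 1 * 1 := by gcongr
    _ = 1 := by norm_num

end IsReducedSVD

end Spectral

/-! ### The max-spectral norm -/

section MaxSpectral

variable {K : ℕ} {a b : Fin K → ℕ}

/-- A collection of matrices as a collection of operators between Euclidean spaces. -/
noncomputable def toOperators (a b : Fin K → ℕ) : MatrixParams a b →L[ℝ]
    ((k : Fin K) → EuclideanSpace ℝ (Fin (b k)) →L[ℝ] EuclideanSpace ℝ (Fin (a k))) :=
  LinearMap.toContinuousLinearMap
    { toFun := fun θ k => LinearMap.toContinuousLinearMap (Matrix.toEuclideanLin (weight θ k))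
      map_add' := fun θ θ' => by
        funext k
        rw [Pi.add_apply, ← map_add, ← map_add]
        rfl
      map_smul' := fun r θ => by
        funext k
        rw [RingHom.id_apply, Pi.smul_apply, ← map_smul, ← map_smul]
        rfl }

theorem toOperators_apply (θ : MatrixParams a b) (k : Fin K) :
    toOperators a b θ k = LinearMap.toContinuousLinearMap (Matrix.toEuclideanLin (weight θ k)) :=
  rfl

/-- Presents the norm as `‖A θ‖` with `A` linear, the form used by the abstract argument. -/
theorem maxSpectralNorm_eq_norm (θ : MatrixParams a b) :
    maxSpectralNorm θ = ‖toOperators a b θ‖ := by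
  refine le_antisymm (Real.iSup_le (fun k => norm_le_pi_norm (toOperators a b θ) k)
    (norm_nonneg _)) ?_
  have h0 : 0 ≤ maxSpectralNorm θ := Real.iSup_nonneg fun k => norm_nonneg _
  refine (pi_norm_le_iff_of_nonneg h0).2 fun k => ?_
  exact le_ciSup (f := fun k => spectralNormOf (weight θ k)) (Set.finite_range _).bddAbove k

theorem toOperators_injective : Function.Injective (toOperators a b) := by
  intro θ θ' h
  ext ⟨k, i, j⟩
  have h1 : weight θ k = weight θ' k :=
    Matrix.toEuclideanLin.injective (LinearMap.toContinuousLinearMap.injective (congrFun h k))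
  exact congrFun (congrFun h1 i) j

theorem inner_eq_sum_trace (v w : MatrixParams a b) :
    inner ℝ v w = ∑ k, ((weight v k).transpose * weight w k).trace := by
  rw [PiLp.inner_apply, Fintype.sum_sigma]
  refine Finset.sum_congr rfl fun k _ => ?_
  rw [Fintype.sum_prod_type, Finset.sum_comm]
  simp [Matrix.trace, Matrix.mul_apply, weight, mul_comm]

end MaxSpectral

/-! ### Muon as steepest descent -/

section Muon

variable {K : ℕ} {a b : Fin K → ℕ} {loss : MatrixParams a b → ℝ} {c : ℝ} {η : ℝ → ℝ}
  {θ g m : ℝ → MatrixParams a b}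

/-- Both the pairing and the unit ball split over the blocks, so the blockwise optimality of polar
factors suffices. -/
theorem IsMuonTrajectory.ae_exists_direction (h : IsMuonTrajectory loss c η θ g m)
    (hη : ∀ t, 0 ≤ t → 0 < η t) : ∀ᵐ t, 0 ≤ t → ∃ u, ‖toOperators a b u‖ ≤ 1 ∧
      (m t ≠ 0 → ‖toOperators a b u‖ = 1) ∧
      (∀ v, ‖toOperators a b v‖ ≤ 1 → inner ℝ v (m t) ≤ inner ℝ u (m t)) ∧
      HasDerivAt θ (-(η t • u)) t := by
  have hstep := (ae_restrict_iff' measurableSet_Ici).1 h.step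
  filter_upwards [hstep] with t ht ht0
  obtain ⟨w, hw, hsvd⟩ := ht ht0
  choose r U σ V hUV hwk using hsvd
  have hηt := hη t ht0
  set u : MatrixParams a b := -((η t)⁻¹ • w)
  have hu : ∀ k, weight u k = U k * (V k).transpose := fun k => by
    have h1 : weight u k = -((η t)⁻¹ • weight w k) := rfl
    rw [h1, hwk, smul_neg, neg_neg, inv_smul_smul₀ hηt.ne']
  have hle : ‖toOperators a b u‖ ≤ 1 := by
    refine (pi_norm_le_iff_of_nonneg zero_le_one).2 fun k => ?_
    -- The operator norm here is definitionally the L2 operator norm of the matrix.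
    rw [toOperators_apply, hu]
    exact (hUV k).norm_polar_le
  refine ⟨u, hle, fun hm => le_antisymm hle ?_, fun v hv => ?_, ?_⟩
  · obtain ⟨k, hk⟩ : ∃ k, weight (m t) k ≠ 0 := by
      by_contra! hcon
      exact hm (by ext ⟨k, i, j⟩; exact congrFun (congrFun (hcon k) i) j)
    refine le_trans ?_ (norm_le_pi_norm (toOperators a b u) k)
    rw [toOperators_apply, hu]
    exact ((hUV k).norm_polar hk).ge
  · rw [inner_eq_sum_trace, inner_eq_sum_trace]
    refine Finset.sum_le_sum fun k _ => ?_
    rw [hu]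
    exact (hUV k).trace_le ((norm_le_pi_norm (toOperators a b v) k).trans hv)
  · rwa [smul_neg, neg_neg, smul_inv_smul₀ hηt.ne']

theorem IsMuonTrajectory.ae_normalizedMSDStep (h : IsMuonTrajectory loss c η θ g m)
    (hη : ∀ t, 0 ≤ t → 0 < η t) : ∀ᵐ t ∂(volume.restrict (Set.Ici (0 : ℝ))),
      m t ≠ 0 → NormalizedMSDStep maxSpectralNorm η θ m t := by
  rw [ae_restrict_iff' measurableSet_Ici]
  filter_upwards [h.ae_exists_direction hη] with t ht ht0 hm
  obtain ⟨u, -, hu1, hu2, hu3⟩ := ht ht0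
  refine ⟨-u, ⟨?_, fun v hv => ?_⟩, by rwa [smul_neg]⟩
  · rw [maxSpectralNorm_eq_norm, map_neg, norm_neg, hu1 hm]
  · rw [maxSpectralNorm_eq_norm] at hv
    have := hu2 (-v) (by rw [map_neg, norm_neg, hv])
    rw [inner_neg_left] at this ⊢
    linarith

end Muon

/-! ### The KKT point -/

section KKT

variable {E : Type*} [NormedAddCommGroup E] [InnerProductSpace ℝ E] [CompleteSpace E]
  [FiniteDimensional ℝ E] {F : Type*} [NormedAddCommGroup F] [NormedSpace ℝ F]

/-- Half the square of the norm `x ↦ ‖A x‖`: vectors dual to `x` are Clarke subgradients. -/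
theorem mem_clarkeSubdiff_half_sq_norm (A : E →L[ℝ] F) {x k : E}
    (hk : ∀ v, inner ℝ k v ≤ ‖A x‖ * ‖A v‖) (hkx : inner ℝ k x = ‖A x‖ ^ 2) :
    k ∈ clarkeSubdiff (fun v => (1 / 2 : ℝ) * ‖A v‖ ^ 2) x := by
  have hlip : LipschitzWith (1 * ‖A‖₊) fun v => ‖A v‖ := lipschitzWith_one_norm.comp A.lipschitz
  have hloc : LocallyLipschitz fun v => (1 / 2 : ℝ) * ‖A v‖ ^ 2 :=
    (show ContDiff ℝ 1 fun r : ℝ => (1 / 2 : ℝ) * r ^ 2 by fun_prop).locallyLipschitz.comp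
      hlip.locallyLipschitz
  have hdense : Dense {u : E | DifferentiableAt ℝ (fun v => (1 / 2 : ℝ) * ‖A v‖ ^ 2) u} := by
    borelize E
    -- Rademacher's theorem for the norm gives differentiability almost everywhere, hence on a dense
    -- set.
    refine (Measure.dense_of_ae (μ := (Measure.addHaar : Measure E))
      hlip.ae_differentiableAt).mono fun u hu => ?_
    exact (DifferentiableAt.pow hu 2).const_mul _
  have hconv : ConvexOn ℝ Set.univ fun v => (1 / 2 : ℝ) * ‖A v‖ ^ 2 := by
    have h1 : ConvexOn ℝ Set.univ fun v => ‖A v‖ :=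
      (convexOn_univ_norm (E := F)).comp_linearMap A.toLinearMap
    exact (h1.pow (fun _ _ => norm_nonneg _) 2).smul (by norm_num : (0 : ℝ) ≤ 1 / 2)
  refine hloc.mem_clarkeSubdiff_of_convexOn hdense hconv fun v => ?_
  rw [inner_sub_right, hkx]
  nlinarith [hk v, sq_nonneg (‖A v‖ - ‖A x‖)]

variable {X : Type*} {n : ℕ}

/-- KKT points from a dual certificate for the normalized direction. -/
theorem exists_isKKTPoint_of_aligned {N : E → ℝ} (A : E →L[ℝ] F) (hN : ∀ v, N v = ‖A v‖)
    {x : Fin n → X} {y : Fin n → ℝ} {f : X → E → ℝ} {L : ℝ} (hL : 1 ≤ L)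
    (hf : IsHomogeneousModel f L) {θbar : E} (hθ : ‖A θbar‖ = 1) {j : Fin n}
    (hj : ∀ i, y j * f (x j) θbar ≤ y i * f (x i) θbar) (hpos : 0 < y j * f (x j) θbar)
    {l : Fin n → E} (hl : ∀ i, l i ∈ clarkeSubdiff (f (x i)) θbar)
    (heuler : ∀ i, inner ℝ (l i) θbar = L * f (x i) θbar) {π : Fin n → ℝ}
    (hπ : π ∈ stdSimplex ℝ (Fin n))
    (hact : ∀ i, y j * f (x j) θbar < y i * f (x i) θbar → π i = 0)
    (hdual : ∀ v, ‖A v‖ ≤ 1 →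
      inner ℝ v (∑ i, π i • y i • l i) ≤ L * (y j * f (x j) θbar)) :
    ∃ α : ℝ, 0 < α ∧ IsKKTPoint N x y f (α • θbar) := by
  have hL0 : 0 < L := zero_lt_one.trans_le hL
  set γ := y j * f (x j) θbar
  set α := γ ^ (-L⁻¹) with hα
  have hα0 : 0 < α := Real.rpow_pos_of_pos hpos _
  have hαL : α ^ L * γ = 1 := by
    rw [hα, ← Real.rpow_mul hpos.le, neg_mul, inv_mul_cancel₀ hL0.ne', Real.rpow_neg_one,
      inv_mul_cancel₀ hpos.ne']
  have hαL0 : 0 < α ^ L := Real.rpow_pos_of_pos hα0 _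
  have hαL1 : 0 < α ^ (L - 1) := Real.rpow_pos_of_pos hα0 _
  have hNα : ‖A (α • θbar)‖ = α := by
    rw [map_smul, norm_smul, hθ, mul_one, Real.norm_of_nonneg hα0.le]
  have hval : ∀ i, y i * f (x i) (α • θbar) = α ^ L * (y i * f (x i) θbar) := fun i => by
    rw [hf _ _ _ hα0]
    ring
  set p := ∑ i, π i • y i • l i with hp
  have hpθ : inner ℝ p θbar = L * γ := by
    have h1 : ∀ i, π i * (y i * f (x i) θbar) = π i * γ := fun i => by
      rcases (hj i).lt_or_eq with h | h
      · rw [hact i h]; ring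
      · rw [← h]
    calc inner ℝ p θbar = ∑ i, L * (π i * (y i * f (x i) θbar)) := by
          rw [hp, sum_inner]
          refine Finset.sum_congr rfl fun i _ => ?_
          rw [inner_smul_left, inner_smul_left, heuler]
          simp
          ring
      _ = L * ((∑ i, π i) * γ) := by
          rw [← Finset.mul_sum, Finset.sum_mul, Finset.sum_congr rfl fun i _ => h1 i]
      _ = L * γ := by rw [hπ.2, one_mul]
  have hpv : ∀ v, inner ℝ p v ≤ L * γ * ‖A v‖ := by
    intro v
    -- `A` need not be injective here: on its kernel `hdual` holds for all multiples of `v`, so the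
    -- pairing cannot be positive.
    rcases (norm_nonneg (A v)).eq_or_lt with h0 | h0
    · rw [← h0, mul_zero]
      by_contra! hcon
      obtain ⟨s, hs⟩ := exists_gt (L * γ / inner ℝ p v)
      have h1 := hdual (s • v) (by rw [map_smul, norm_smul, ← h0, mul_zero]; exact zero_le_one)
      rw [inner_smul_left, real_inner_comm] at h1
      rw [div_lt_iff₀ hcon] at hs
      simp only [conj_trivial] at h1
      linarith
    · have h1 := hdual (‖A v‖⁻¹ • v) (by
        rw [map_smul, norm_smul, norm_inv, norm_norm, inv_mul_cancel₀ h0.ne'])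
      rw [inner_smul_left, real_inner_comm] at h1
      simp only [conj_trivial] at h1
      rwa [inv_mul_le_iff₀ h0, mul_comm] at h1
  have hLγ : 0 < L * γ := mul_pos hL0 hpos
  -- `α = γ ^ (-1 / L)` makes the minimal margin 1, and `p / (L * γ)` is a norming functional of
  -- `θbar`. Subgradients scale by `α ^ (L - 1)` at `α • θbar`, which the multipliers undo.
  refine ⟨α, hα0, fun i => ?_, (α / (L * γ)) • p, ?_,
    fun i => α / (L * γ) * π i * (α ^ (L - 1))⁻¹, fun i => α ^ (L - 1) • l i,
    fun i => ?_, fun i => ?_, ?_, ?_⟩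
  · rw [hval, ← hαL]
    gcongr
    exact hj i
  · simp only [hN]
    refine mem_clarkeSubdiff_half_sq_norm A (fun v => ?_) ?_
    · rw [hNα, inner_smul_left, conj_trivial]
      calc α / (L * γ) * inner ℝ p v ≤ α / (L * γ) * (L * γ * ‖A v‖) := by
            gcongr
            exact hpv v
        _ = α * ‖A v‖ := by field_simp
    · rw [hNα, inner_smul_left, inner_smul_right, hpθ, conj_trivial]
      field_simp
  · have := hπ.1 i
    positivity
  · exact smul_mem_clarkeSubdiff_of_homogeneous (hf (x i)) hα0 (hl i)
  · rw [sub_eq_zero, hp, Finset.smul_sum]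
    refine Finset.sum_congr rfl fun i _ => ?_
    simp only [smul_smul]
    congr 1
    field_simp
  · refine Finset.sum_eq_zero fun i _ => ?_
    rcases (hj i).lt_or_eq with h | h
    · simp only [hact i h, mul_zero, zero_mul]
    · rw [hval, ← h, hαL, sub_self, mul_zero]

end KKT

/-! ### The training loss -/

section TrainingLoss

variable {E : Type*} [NormedAddCommGroup E] {X : Type*} {n : ℕ} {φ : ℝ → ℝ} {x : Fin n → X} {y : Fin n → ℝ} {f : X → E → ℝ}

theorem IsLogConcaveExpTailed.locallyLipschitz_trainingLoss (hφ : IsLogConcaveExpTailed φ)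
    (hf : ∀ u, LocallyLipschitz (f u)) : LocallyLipschitz (trainingLoss φ x y f) := by
  have h1 : ∀ i, LocallyLipschitz fun θ => Real.exp (-φ (y i * f (x i) θ)) := fun i =>
    (show ContDiff ℝ 1 fun r : ℝ => Real.exp (-φ (y i * r)) from
      Real.contDiff_exp.comp (((hφ.contDiff.of_le one_le_two).comp
        (contDiff_const.mul contDiff_id)).neg)).locallyLipschitz.comp (hf (x i))
  have h2 : ∀ s : Finset (Fin n),
      LocallyLipschitz fun θ => ∑ i ∈ s, Real.exp (-φ (y i * f (x i) θ)) := by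
    intro s
    induction s using Finset.induction_on with
    | empty => simpa using LocallyLipschitz.const (0 : ℝ)
    | insert i s hi ih =>
      simp only [Finset.sum_insert hi]
      exact (h1 i).add ih
  exact h2 Finset.univ

theorem IsLogConcaveExpTailed.contDiff_trainingLoss [InnerProductSpace ℝ E]
    (hφ : IsLogConcaveExpTailed φ)
    (hf : ∀ u, ContDiff ℝ 1 (f u)) : ContDiff ℝ 1 (trainingLoss φ x y f) :=
  ContDiff.sum fun i _ => Real.contDiff_exp.comp
    (((hφ.contDiff.of_le one_le_two).comp (contDiff_const.mul (hf (x i)))).neg)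

theorem IsLogConcaveExpTailed.gradient_trainingLoss [InnerProductSpace ℝ E] [CompleteSpace E]
    (hφ : IsLogConcaveExpTailed φ)
    (hf : ∀ u, ContDiff ℝ 1 (f u)) (θ : E) : gradient (trainingLoss φ x y f) θ =
      -∑ i, (Real.exp (-φ (y i * f (x i) θ)) * deriv φ (y i * f (x i) θ) * y i) •
        gradient (f (x i)) θ := by
  refine HasGradientAt.gradient ?_
  rw [hasGradientAt_iff_hasFDerivAt]
  have h1 : HasFDerivAt (trainingLoss φ x y f) (∑ i, Real.exp (-φ (y i * f (x i) θ)) •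
      -(deriv φ (y i * f (x i) θ) • y i • fderiv ℝ (f (x i)) θ)) θ :=
    HasFDerivAt.fun_sum fun i _ =>
      (((hφ.differentiable _).hasDerivAt.comp_hasFDerivAt θ
        (((hf (x i)).differentiable one_ne_zero θ).hasFDerivAt.const_mul (y i))).neg).exp
  refine h1.congr_fderiv ?_
  rw [map_neg, map_sum, ← Finset.sum_neg_distrib]
  refine Finset.sum_congr rfl fun i _ => ?_
  rw [map_smul, toDual_gradient, smul_neg, smul_smul, smul_smul, mul_assoc]

/-- For a `C¹` homogeneous model and a trajectory converging in direction, the gradients of the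
loss decompose through the gradients of the model, which converge after normalization. -/
theorem normalizedSubgradientsConverge_of_contDiff [InnerProductSpace ℝ E]
    [CompleteSpace E] {N : E → ℝ} (hN0 : ∀ v, 0 ≤ N v)
    (hφ : IsLogConcaveExpTailed φ) (hf : ∀ u, ContDiff ℝ 1 (f u)) {L : ℝ}
    (hhom : IsHomogeneousModel f L) {θ g : ℝ → E} {θbar : E}
    (hg : ∀ t, 0 ≤ t → g t ∈ clarkeSubdiff (trainingLoss φ x y f) (θ t))
    (hnt : IsNontrivialTrajectory N θ)
    (hdir : Tendsto (fun t => (N (θ t))⁻¹ • θ t) atTop (𝓝 θbar)) :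
    NormalizedSubgradientsConverge N φ x y f L θ g := by
  refine ⟨fun i t => gradient (f (x i)) (θ t), fun i t _ =>
    gradient_mem_clarkeSubdiff ((hf _).differentiable one_ne_zero _), fun t ht => ?_,
    fun i => ⟨gradient (f (x i)) θbar, ?_⟩⟩
  · have := hg t ht
    rw [(hφ.contDiff_trainingLoss hf).clarkeSubdiff_eq] at this
    rw [this, hφ.gradient_trainingLoss hf]
  · obtain ⟨p, hp, t₀, -, ht₀⟩ := hnt
    refine (((hf (x i)).continuous_gradient.tendsto θbar).comp hdir).congr' ?_
    filter_upwards [eventually_ge_atTop t₀] with t ht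
    have hNt : 0 < (N (θ t))⁻¹ := inv_pos.2 (hp.trans_le (ht₀ t ht))
    -- Rescaling by `1 / N` turns the normalized gradient at `θ t` into the gradient at the
    -- normalized point, where continuity applies.
    have := (hasGradientAt_smul_of_homogeneous (hhom (x i)) hNt
      ((hf (x i)).differentiable one_ne_zero (θ t)).hasGradientAt).gradient
    rw [Real.inv_rpow (hN0 _)] at this
    exact this

end TrainingLoss

/-- The asymptotics of Muon trajectories. -/
theorem IsMuonTrajectory.exists_isKKTPoint {X : Type*} {n K : ℕ} {a b : Fin K → ℕ}
    {x : Fin n → X} {y : Fin n → ℝ} {f : X → MatrixParams a b → ℝ} {φ : ℝ → ℝ}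
    (hφ : IsLogConcaveExpTailed φ) {c : ℝ} (hc : 0 < c) {η : ℝ → ℝ} (hη : ∀ t, 0 ≤ t → 0 < η t)
    {θ g m : ℝ → MatrixParams a b} (hMuon : IsMuonTrajectory (trainingLoss φ x y f) c η θ g m)
    {L : ℝ} {θbar : MatrixParams a b} (hL : 1 ≤ L) (hhom : IsHomogeneousModel f L)
    (hsch : IsMSDSchedule η L) (hnt : IsNontrivialTrajectory maxSpectralNorm θ)
    (hdir : ConvergesInDirection maxSpectralNorm x y f θ θbar)
    (hlip : ∀ u, LocallyLipschitz (f u))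
    (hsub : NormalizedSubgradientsConverge maxSpectralNorm φ x y f L θ g)
    (hchain : ∀ i, ∀ᵐ t : ℝ, ∀ w r, HasDerivAt θ w t → HasDerivAt (fun s => f (x i) (θ s)) r t →
      ∀ h ∈ clarkeSubdiff (f (x i)) (θ t), inner ℝ h w = r) :
    (∀ᶠ t in atTop, m t ≠ 0) ∧
      ∃ α : ℝ, 0 < α ∧ IsKKTPoint maxSpectralNorm x y f (α • θbar) := by
  obtain ⟨h, hmem, hgeq, hlim⟩ := hsub
  choose l hl using hlim
  obtain ⟨hdirt, hmargin⟩ := hdir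
  simp only [maxSpectralNorm_eq_norm] at hl hdirt
  set A := toOperators a b
  obtain ⟨p, hp, hpN⟩ : ∃ p, 0 < p ∧ ∀ᶠ t in atTop, p ≤ ‖A (θ t)‖ := by
    obtain ⟨p, hp, t₀, -, ht₀⟩ := hnt
    refine ⟨p, hp, (eventually_ge_atTop t₀).mono fun t ht => ?_⟩
    rw [← maxSpectralNorm_eq_norm]
    exact ht₀ t ht
  have hNpos : ∀ᶠ t in atTop, 0 < ‖A (θ t)‖ := hpN.mono fun t ht => hp.trans_le ht
  have hθbar : ‖A θbar‖ = 1 := by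
    refine tendsto_nhds_unique (((A.continuous.tendsto θbar).comp hdirt).norm) ?_
    refine tendsto_const_nhds.congr' ?_
    filter_upwards [hNpos] with t ht
    rw [Function.comp_apply, map_smul, norm_smul, norm_inv, norm_norm, inv_mul_cancel₀ ht.ne']
  have hγ : ∀ i, 0 < y i * f (x i) θbar := fun i => by
    refine hmargin.trans_le ?_
    rw [hardMargin]
    refine (ciInf_le (Set.finite_range _).bddBelow i).trans ?_
    rw [maxSpectralNorm_eq_norm, hθbar, inv_one, one_smul]
  -- An infimum over an empty index set is 0, which contradicts the positive margin.
  have hne : Nonempty (Fin n) := by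
    by_contra hcon
    rw [not_nonempty_iff] at hcon
    rw [hardMargin, Real.iInf_of_isEmpty] at hmargin
    exact lt_irrefl _ hmargin
  -- Normalized subgradients are subgradients at normalized points; outer semicontinuity passes to
  -- the limit.
  have hlmem : ∀ i, l i ∈ clarkeSubdiff (f (x i)) θbar := fun i => by
    refine (hlip (x i)).mem_clarkeSubdiff_of_tendsto hdirt (hl i) ?_
    filter_upwards [hNpos, eventually_ge_atTop 0] with t ht ht0
    rw [← Real.inv_rpow ht.le]
    exact smul_mem_clarkeSubdiff_of_homogeneous (hhom (x i)) (inv_pos.2 ht) (hmem i t ht0)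
  have heuler : ∀ i, inner ℝ (l i) θbar = L * f (x i) θbar := fun i =>
    inner_clarkeSubdiff_of_homogeneous (hhom (x i)) (hlip (x i)).continuous (hlmem i)
  have hac : ∀ s t, 0 ≤ s → 0 ≤ t → AbsolutelyContinuousOnInterval θ s t := fun s t hs ht =>
    hMuon.arc.absolutelyContinuousOnInterval hs ht
  have hgb : ∀ T, 0 ≤ T → ∃ C, ∀ s ∈ Set.Icc 0 T, ‖g s‖ ≤ C := by
    intro T hT
    have hcont := (hac 0 T le_rfl hT).continuousOn
    rw [Set.uIcc_of_le hT] at hcont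
    obtain ⟨C, hC⟩ := (hφ.locallyLipschitz_trainingLoss hlip).exists_norm_clarkeSubdiff_le
      (isCompact_Icc.image_of_continuousOn hcont)
    exact ⟨C, fun s hs => hC _ ⟨s, hs, rfl⟩ _ (hMuon.subgrad s hs.1)⟩
  have hgi : ∀ T, 0 ≤ T → IntervalIntegrable g volume 0 T := by
    intro T hT
    obtain ⟨C, hC⟩ := hgb T hT
    rw [intervalIntegrable_iff_integrableOn_Icc_of_le hT]
    have h1 := hMuon.measurable.mono_measure
      (Measure.restrict_mono (Set.Icc_subset_Ici_self : Set.Icc 0 T ⊆ Set.Ici 0) le_rfl)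
    refine Integrable.of_bound h1 C ?_
    rw [ae_restrict_iff' measurableSet_Icc]
    exact ae_of_all _ hC
  -- The labels are absorbed into the margins and their subgradients.
  have hflow : IsMarginFlow A φ c L η θ g m θbar (fun i t => y i * f (x i) (θ t))
      (fun i t => y i • h i t) (fun i => y i • l i) (fun i => y i * f (x i) θbar) :=
    { tailed := hφ
      c_pos := hc
      one_le := hL
      rate_pos := hη
      schedule := hsch
      bound := by
        -- In finite dimension, injectivity of `A` bounds the Euclidean norm by `‖A ·‖`.
        obtain ⟨C, -, hC⟩ := (LinearMap.injective_iff_antilipschitz A.toLinearMap).1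
          toOperators_injective
        exact ⟨C, C.coe_nonneg, fun v => by
          simpa using hC.le_mul_dist v 0⟩
      curve_ac := hac
      nontrivial := ⟨p, hp, hpN⟩
      norm_dir := hθbar
      step := by
        filter_upwards [hMuon.ae_exists_direction hη] with t ht ht0
        obtain ⟨u, h1, -, h2, h3⟩ := ht ht0
        exact ⟨u, h1, h2, h3⟩
      margin_ac := fun i s t hs ht =>
        ((hac s t hs ht).comp_locallyLipschitz (hlip (x i))).const_mul (y i)
      chain := by
        filter_upwards [ae_all_iff.2 hchain] with t ht ht0 i w r hw hr
        -- Labels are arbitrary reals in this lemma; a zero label makes both sides vanish.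
        rcases eq_or_ne (y i) 0 with hy | hy
        · simp only [hy, zero_mul] at hr
          simp [hy, hr.unique (hasDerivAt_const t (0 : ℝ))]
        · have h1 := hr.const_mul (y i)⁻¹
          simp only [inv_mul_cancel_left₀ hy] at h1
          rw [inner_smul_left, ht i w _ hw h1 _ (hmem i t ht0), conj_trivial,
            mul_inv_cancel_left₀ hy]
      grad_eq := fun t ht => by
        rw [hgeq t ht]
        simp only [smul_smul]
      tendsto_subgrad := fun i => by
        refine ((hl i).const_smul (y i)).congr fun t => ?_
        rw [smul_comm]
      tendsto_margin := fun i => by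
        refine ((((hlip (x i)).continuous.tendsto θbar).comp hdirt).const_mul (y i)).congr' ?_
        filter_upwards [hNpos] with t ht
        rw [Function.comp_apply, hhom _ _ _ (inv_pos.2 ht), Real.inv_rpow ht.le]
        ring
      margin_pos := hγ
      euler := fun i => by
        rw [inner_smul_left, heuler, conj_trivial]
        ring
      grad_integrable := hgi
      grad_bdd := hgb
      momentum := hMuon.momentum }
  refine ⟨hflow.eventually_momentum_ne_zero, ?_⟩
  obtain ⟨j, hj⟩ := Finite.exists_min fun i => y i * f (x i) θbar
  obtain ⟨π, hπ, hact, hdual⟩ := hflow.exists_aligned j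
  exact exists_isKKTPoint_of_aligned A maxSpectralNorm_eq_norm hL hhom hθbar hj (hγ j) hlmem heuler
    hπ hact hdual

theorem mainTheorem5 {n d K : ℕ} {a b : Fin K → ℕ}
    (x : Fin n → EuclideanSpace ℝ (Fin d)) (y : Fin n → ℝ) (hy : ∀ i, y i = 1 ∨ y i = -1)
    (f : EuclideanSpace ℝ (Fin d) → MatrixParams a b → ℝ)
    (φ : ℝ → ℝ) (hφ : IsLogConcaveExpTailed φ)
    (c : ℝ) (hc : 0 < c) (η : ℝ → ℝ) (hη : ∀ t, 0 ≤ t → 0 < η t)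
    (θ g m : ℝ → MatrixParams a b)
    (hMuon : IsMuonTrajectory (trainingLoss φ x y f) c η θ g m) :
    -- Muon is normalized momentum steepest descent for the max-spectral norm
    (∀ᵐ t ∂(volume.restrict (Set.Ici (0 : ℝ))),
      m t ≠ 0 → NormalizedMSDStep maxSpectralNorm η θ m t) ∧
    ((∀ᵐ t ∂(volume.restrict (Set.Ici (0 : ℝ))), m t ≠ 0) →
      IsNormalizedMSD maxSpectralNorm (trainingLoss φ x y f) c η θ g m) ∧
    -- the limit direction is the direction of a KKT point
    (∀ (L : ℝ) (θbar : MatrixParams a b), 1 ≤ L →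
      IsHomogeneousModel f L →
      IsMSDSchedule η L →
      IsNontrivialTrajectory maxSpectralNorm θ →
      ConvergesInDirection maxSpectralNorm x y f θ θbar →
      ((∀ u, ContDiff ℝ 1 (f u)) ∨
        ((∀ u, LocallyLipschitz (f u) ∧ IsWhitneyC1Stratifiable (f u)) ∧
          NormalizedSubgradientsConverge maxSpectralNorm φ x y f L θ g)) →
      (∀ᶠ t in atTop, m t ≠ 0) ∧
      ∃ α : ℝ, 0 < α ∧ IsKKTPoint maxSpectralNorm x y f (α • θbar)) := by
  refine ⟨hMuon.ae_normalizedMSDStep hη, fun hm => ⟨hMuon.toIsMomentumSystem, ?_⟩,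
    fun L θbar hL hhom hsch hnt hdir hf => ?_⟩
  · filter_upwards [hm, hMuon.ae_normalizedMSDStep hη] with t h1 h2 using h2 h1
  -- The cases differ only in the source of the chain rule and of the convergent subgradients:
  -- homogeneity and smoothness in the first, stratification and assumption in the second.
  · rcases hf with hf | ⟨hf, hsub⟩
    · refine hMuon.exists_isKKTPoint hφ hc hη hL hhom hsch hnt hdir
        (fun u => (hf u).locallyLipschitz)
        (normalizedSubgradientsConverge_of_contDiff
          (fun v => by rw [maxSpectralNorm_eq_norm]; exact norm_nonneg _)
          hφ hf hhom hMuon.subgrad hnt hdir.1) fun i => ae_of_all _ fun t w r hw hr h hh => ?_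
      rw [(hf (x i)).clarkeSubdiff_eq] at hh
      rw [hh, inner_gradient_left]
      exact (((hf (x i)).differentiable one_ne_zero (θ t)).hasFDerivAt.comp_hasDerivAt t
        hw).unique hr
    · exact hMuon.exists_isKKTPoint hφ hc hη hL hhom hsch hnt hdir (fun u => (hf u).1) hsub
        fun i => (hf (x i)).2.ae_inner_eq (hf (x i)).1.continuous θ
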